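/- **Setting.** Let $d\ge 1$. $Q$ (target) and $P$ (source) are probability distributions on $\mathbb R^d\times\{0,1\}$ with marginals $Q_X,P_X$ on $\mathbb R^d$, supports $\Omega=\mathrm{supp}\,Q_X$, $\Omega_P=\mathrm{supp}\,P_X$, and regression functions $\eta^Q,\eta^P:\mathbb R^d\to[0,1]$, i.e. $\eta^Q(x)=Q(Y=1\mid X=x)$, $\eta^P(x)=P(Y=1\mid X=x)$. For $f:\mathbb R^d\to\{0,1\}$ put $\mathcal E_Q(f)=Q(Y\ne f(X))-Q(Y\ne f_Q^*(X))$, with $f_Q^*=\mathbf 1\{\eta^Q\ge 1/2\}$. $B(x,r)$ is the closed Euclidean ball and $\lambda$ is Lebesgue measure. The signal strength is $s(x)=\max\{\mathrm{sgn}(\eta^Q(x)-\tfrac12)(\eta^P(x)-\tfrac12),0\}$ for $x\in\Omega_P$ and $s(x)=0$ for $x\notin\Omega_P$ (where $P$ does not determine $\eta^P$), and the signal transfer set is $$\Omega^+=\Omega^+(\gamma,C_\gamma)=\{x\in\Omega: s(x)\ge C_\gamma|\eta^Q(x)-\tfrac12|^\gamma\}.$$ Fix $\alpha\ge 0$, $\beta,\beta_P\in[0,1]$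 and $\gamma,C_\alpha,C_\gamma,C_\beta,C_{\beta_P},\mu^-,\mu^+,c_\mu,r_\mu>0$. For a function $\varepsilon$ that is continuous and increasing on $[0,1/2]$, $\Pi^{NP}$ is the set of pairs $(Q,P)$ such that * $Q_X(0<|\eta^Q(X)-\tfrac12|\le t)\le C_\alpha t^\alpha$ for all $t>0$; * $\mathbb E_Q\big[|\eta^Q(X)-\tfrac12|\,\mathbf 1\{s(X)\le C_\gamma|\eta^Q(X)-\tfrac12|^\gamma,\ |\eta^Q(X)-\tfrac12|\le z\}\big]\le\varepsilon(z)$ for all $z\in[0,\tfrac12]$; * $|\eta^Q(x)-\eta^Q(x')|\le C_\beta\|x-x'\|^\beta$ and $|\eta^P(x)-\eta^P(x')|\le C_{\beta_P}\|x-x'\|^{\beta_P}$ for all $x,x'\in\mathbb R^d$; * each of $\nu=Q_X$ and $\nu=P_X$ is absolutely continuous with compact support $S_\nu$, has density with values in $[\mu^-,\mu^+]$ (a.e.) on $S_\nu$, and $\lambda(B(x,r)\cap S_\nu)\ge c_\mu\lambda(B(x,r))$ for $x\in S_\nu$, $0<r<r_\mu$. Given independent iid samples $\mathcal D_Q$ from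 $Q$ (size $n_Q$) and $\mathcal D_P$ from $P$ (size $n_P$), let $\hat\eta^Q(x)$, $\hat\eta^P(x)$ be the averages of the labels of the $k_Q$, resp. $k_P$, nearest neighbours of $x$ in $\mathcal D_Q$, resp. $\mathcal D_P$ (ties broken by index). The TAB $K$-NN classifier is $\hat f(x)=\mathbf 1\{\hat\eta^Q(x)\ge\frac12\}$ if $|\hat\eta^Q(x)-\frac12|\ge\tau$, and $\hat f(x)=\mathbf 1\{\hat\eta^P(x)\ge\frac12\}$ otherwise. Fix $c_Q,c_P,c_b,A>0$ and $0<c_1\le c_2$, and take $k_Q=\lfloor c_Qn_Q^{2\beta/(2\beta+d)}\rfloor$, $k_P=\lfloor c_Pn_P^{2\gamma\beta/(2\gamma\beta+d)}\rfloor$ and $c_1\le\tau/\big(\log(n_Q\vee n_P)\,k_Q^{-1/2}\big)\le c_2$. For $r\ge 0$ and $S\subset\mathbb R^d$ write $W_S(r)=\{x\in\Omega^+: B(x,r)\cap S\not\subset\Omega^+\}$, and let $$\Omega^b=\Big\{x\in W_{\Omega\cap\Omega_P}\big(c_bn_P^{-\frac{1}{2\gamma\beta+d}}\big):|\eta^Q(x)-\tfrac12|\le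 c_bn_P^{-\frac{\beta_P/\gamma}{2\gamma\beta+d}}\Big\},\qquad \varepsilon_b=\int_{\Omega^b}|\eta^Q-\tfrac12|\,dQ_X .$$ Consider the two bounds $$\text{(a)}\quad \varepsilon_b\le C\,n_P^{-\frac{\beta(1+\alpha)}{2\gamma\beta+d}}\qquad\text{for all } n_P\ge N;$$ $$\text{(b)}\quad \mathbb E_{(\mathcal D_Q,\mathcal D_P)}\mathcal E_Q(\hat f)\le C\Big[n_P^{-\frac{\beta(1+\alpha)}{2\gamma\beta+d}}\wedge\Big(\log^{1+\alpha}(n_Q\vee n_P)\,n_Q^{-\frac{\beta(1+\alpha)}{2\beta+d}}\Big)+\varepsilon\big(2\tau\wedge\tfrac12\big)\Big]$$ for all $n_Q,n_P\ge N$ with $n_Q^{\frac{d}{2\beta+d}}\exp\big(-c_Qn_Q^{\frac{2\beta}{2\beta+d}}\big)\le A\,n_P^{-\frac{\beta(1+\alpha)}{2\gamma\beta+d}}$ and all $\tau$ as above. **Corollary.** Suppose $\gamma\beta\ge\beta_P$. 1. *Signal transfer boundary as part of the decision boundary.* There are $C,N$, depending only on the constants fixed above, such that (a) and (b) hold for every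 $\varepsilon$ and every $(Q,P)\in\Pi^{NP}$ for which $\eta^Q$ is continuous on $\Omega$, $\eta^P$ is continuous on $\Omega_P$, and $\partial\Omega^+\subset\{x\in\Omega:\eta^Q(x)=\frac12\}$, where $\partial$ is the topological boundary in $\mathbb R^d$. 2. *Signal transfer boundary margin.* Let $\alpha_r\in[0,\infty]$ and $r_m,C_r>0$ with $\beta_P/\gamma+\alpha_r\ge\beta(1+\alpha)$. For $S\subset\mathbb R^d$ consider the condition $$(M_S)\qquad Q_X\big(W_S(r)\big)\le C_rr^{\alpha_r}\ \text{ for all } 0<r<r_m,$$ which for $\alpha_r=\infty$ is understood as: $\|x-y\|\ge r_m$ for all $x\in\Omega^+$ and $y\in S\setminus\Omega^+$. There are $C,N$, depending only on the constants fixed above and on $\alpha_r,r_m,C_r$, such that for every $\varepsilon$ and every $(Q,P)\in\Pi^{NP}$: if $(M_{\Omega\cap\Omega_P})$ holds, then (a) holds; if $(M_{\Omega_P})$ holds (the same condition when $\Omega_P\subset\Omega$), then (b) holds. -/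

import Mathlib

open MeasureTheory Set
open scoped ENNReal

noncomputable section

namespace TransferKNN

/-- The feature space `ℝ^d` with its Euclidean norm. -/
abbrev Feature (d : ℕ) := EuclideanSpace ℝ (Fin d)

/-- A labelled observation `(X, Y)`; the label `Y ∈ {0, 1}` is a Boolean (`true` is `1`). -/
abbrev Obs (d : ℕ) := Feature d × Bool

/-- The numerical value `0` or `1` of a label. -/
def labelValue (y : Bool) : ℝ := if y then 1 else 0

/-! ### Regression functions, Bayes classifier, excess risk -/

/-- `η` is (a version of) the regression function `η(x) = μ(Y = 1 | X = x)`. -/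
structure IsRegressionFunction {d : ℕ} (μ : Measure (Obs d)) (η : Feature d → ℝ) : Prop where
  measurable : Measurable η
  mem_Icc : ∀ x, η x ∈ Icc (0 : ℝ) 1
  integral_eq : ∀ A : Set (Feature d), MeasurableSet A →
    μ.real (A ×ˢ {true}) = ∫ x in A, η x ∂μ.fst

/-- Misclassification rate `R(f) = Q(Y ≠ f(X))`. -/
def misclassificationRate {d : ℕ} (Q : Measure (Obs d)) (f : Feature d → Bool) : ℝ :=
  Q.real {z | z.2 ≠ f z.1}

open Classical in
/-- The classifier `1{η ≥ 1/2}`. -/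
def plugIn {d : ℕ} (η : Feature d → ℝ) (x : Feature d) : Bool := decide (1 / 2 ≤ η x)

/-- Excess risk `R(f) - R(f*)` with `f* = 1{η ≥ 1/2}` the Bayes classifier. -/
def excessRisk {d : ℕ} (Q : Measure (Obs d)) (η : Feature d → ℝ) (f : Feature d → Bool) : ℝ :=
  misclassificationRate Q f - misclassificationRate Q (plugIn η)

/-! ### The `K`-nearest-neighbour TAB classifier -/

open Classical in
/-- Number of sample points that precede `X i` when the sample is ordered by the distance to `x`
(ties are broken by the index). -/
def neighborRank {d n : ℕ} (D : Fin n → Obs d) (x : Feature d) (i : Fin n) : ℕ :=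
  (Finset.univ.filter fun j : Fin n =>
    dist (D j).1 x < dist (D i).1 x ∨ (dist (D j).1 x = dist (D i).1 x ∧ j < i)).card

open Classical in
/-- The `K`-NN estimate: average of the labels of the `k` sample points closest to `x`. -/
def knnEstimate {d n : ℕ} (k : ℕ) (D : Fin n → Obs d) (x : Feature d) : ℝ :=
  (k : ℝ)⁻¹ * ∑ i ∈ Finset.univ.filter (fun i : Fin n => neighborRank D x i < k),
    labelValue (D i).2

open Classical in
/-- The TAB `K`-NN classifier with threshold `τ`: use the target estimate where it is at distance
at least `τ` from `1/2`, the source estimate elsewhere. -/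
def tabClassifier {d nQ nP : ℕ} (kQ kP : ℕ) (τ : ℝ)
    (D : (Fin nQ → Obs d) × (Fin nP → Obs d)) (x : Feature d) : Bool :=
  if τ ≤ |knnEstimate kQ D.1 x - 1 / 2| then plugIn (knnEstimate kQ D.1) x
  else plugIn (knnEstimate kP D.2) x

/-- Law of `(D_Q, D_P)`: independent iid samples of sizes `nQ` from `Q` and `nP` from `P`. -/
def sampleLaw {d : ℕ} (Q P : Measure (Obs d)) (nQ nP : ℕ) :
    Measure ((Fin nQ → Obs d) × (Fin nP → Obs d)) :=
  (Measure.pi fun _ : Fin nQ => Q).prod (Measure.pi fun _ : Fin nP => P)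

/-! ### The class of distribution pairs -/

/-- The parameters of the non-parametric class. -/
structure NPParams where
  (α Cα γ Cγ β Cβ βP CβP μlo μhi cμ rμ : ℝ)

/-- The admissible ranges of the parameters. -/
structure NPParams.Valid (θ : NPParams) : Prop where
  α_nonneg : 0 ≤ θ.α
  Cα_pos : 0 < θ.Cα
  γ_pos : 0 < θ.γ
  Cγ_pos : 0 < θ.Cγ
  β_mem : θ.β ∈ Icc (0 : ℝ) 1
  Cβ_pos : 0 < θ.Cβ
  βP_mem : θ.βP ∈ Icc (0 : ℝ) 1
  CβP_pos : 0 < θ.CβP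
  μlo_pos : 0 < θ.μlo
  μhi_pos : 0 < θ.μhi
  cμ_pos : 0 < θ.cμ
  rμ_pos : 0 < θ.rμ

/-- A target distribution `Q` and a source distribution `P` together with functions that serve as
their regression functions (see `InClassNP`). -/
structure Pair (d : ℕ) where
  Q : Measure (Obs d)
  P : Measure (Obs d)
  ηQ : Feature d → ℝ
  ηP : Feature d → ℝ

namespace Pair

variable {d : ℕ}

/-- `Ω = supp Q_X`. -/
def Ω (p : Pair d) : Set (Feature d) := p.Q.fst.support

/-- `Ω_P = supp P_X`. -/
def ΩP (p : Pair d) : Set (Feature d) := p.P.fst.support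

open Classical in
/-- Signal strength `s(x) = max (sgn(η^Q(x) - 1/2) (η^P(x) - 1/2)) 0`. Outside `Ω_P` the
regression function `η^P` is not determined by `P`, and the signal strength is `0`. -/
def signal (p : Pair d) (x : Feature d) : ℝ :=
  if x ∈ p.ΩP then max (Real.sign (p.ηQ x - 1 / 2) * (p.ηP x - 1 / 2)) 0 else 0

/-- The signal transfer set `Ω⁺(γ, C_γ) = {x ∈ Ω : s(x) ≥ C_γ |η^Q(x) - 1/2|^γ}`. -/
def strongSet (p : Pair d) (γ Cγ : ℝ) : Set (Feature d) :=
  {x ∈ p.Ω | Cγ * |p.ηQ x - 1 / 2| ^ γ ≤ p.signal x}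

/-- Points of `Ω⁺` whose closed `r`-ball meets `S` outside `Ω⁺`. -/
def nearWeak (p : Pair d) (γ Cγ : ℝ) (S : Set (Feature d)) (r : ℝ) : Set (Feature d) :=
  {x ∈ p.strongSet γ Cγ | ¬ (Metric.closedBall x r ∩ S ⊆ p.strongSet γ Cγ)}

/-- The boundary `Ω^b ⊆ Ω⁺` of the signal transfer set at source sample size `nP`. -/
def transferBoundary (p : Pair d) (θ : NPParams) (cb : ℝ) (nP : ℕ) : Set (Feature d) :=
  {x ∈ p.nearWeak θ.γ θ.Cγ (p.Ω ∩ p.ΩP) (cb * (nP : ℝ) ^ (-(1 / (2 * θ.γ * θ.β + d)))) |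
    |p.ηQ x - 1 / 2| ≤ cb * (nP : ℝ) ^ (-((θ.βP / θ.γ) / (2 * θ.γ * θ.β + d)))}

/-- `ε_b = ∫_{Ω^b} |η^Q - 1/2| dQ_X`. -/
def boundaryRisk (p : Pair d) (θ : NPParams) (cb : ℝ) (nP : ℕ) : ℝ :=
  ∫ x in p.transferBoundary θ cb nP, |p.ηQ x - 1 / 2| ∂p.Q.fst

end Pair

/-- Margin assumption. -/
def MarginAssumption {d : ℕ} (θ : NPParams) (p : Pair d) : Prop :=
  ∀ t : ℝ, 0 < t →
    p.Q.fst.real {x | 0 < |p.ηQ x - 1 / 2| ∧ |p.ηQ x - 1 / 2| ≤ t} ≤ θ.Cα * t ^ θ.α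

/-- `ε` is an ambiguity level of the pair: continuous and increasing on `[0, 1/2]`, and it
bounds the risk of the weak-signal points with `|η^Q - 1/2| ≤ z`. -/
structure AmbiguityLevel {d : ℕ} (θ : NPParams) (ε : ℝ → ℝ) (p : Pair d) : Prop where
  continuousOn : ContinuousOn ε (Icc 0 (1 / 2))
  monotoneOn : MonotoneOn ε (Icc 0 (1 / 2))
  integral_le : ∀ z ∈ Icc (0 : ℝ) (1 / 2),
    ∫ x in {x | p.signal x ≤ θ.Cγ * |p.ηQ x - 1 / 2| ^ θ.γ ∧ |p.ηQ x - 1 / 2| ≤ z},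
      |p.ηQ x - 1 / 2| ∂p.Q.fst ≤ ε z

/-- The Hölder class `H(β, C)` of functions on `ℝ^d`, `0 ≤ β ≤ 1`. -/
def HolderClass {d : ℕ} (β C : ℝ) (g : Feature d → ℝ) : Prop :=
  ∀ x x' : Feature d, |g x - g x'| ≤ C * ‖x - x'‖ ^ β

/-- Strong density condition for a marginal distribution `ν` on `ℝ^d`. -/
structure StrongDensity {d : ℕ} (θ : NPParams) (ν : Measure (Feature d)) : Prop where
  absolutelyContinuous : ν ≪ volume
  isCompact_support : IsCompact ν.support
  density_mem : ∀ᵐ x ∂(volume.restrict ν.support), (ν.rnDeriv volume x).toReal ∈ Icc θ.μlo θ.μhi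
  ball_le : ∀ x ∈ ν.support, ∀ r : ℝ, 0 < r → r < θ.rμ →
    θ.cμ ≤ volume.real (Metric.closedBall x r ∩ ν.support) / volume.real (Metric.closedBall x r)

/-- The class `Π^NP` of pairs, with parameters `θ` and ambiguity level `ε`. -/
structure InClassNP {d : ℕ} (θ : NPParams) (ε : ℝ → ℝ) (p : Pair d) : Prop where
  prob_Q : IsProbabilityMeasure p.Q
  prob_P : IsProbabilityMeasure p.P
  regression_Q : IsRegressionFunction p.Q p.ηQ
  regression_P : IsRegressionFunction p.P p.ηP
  margin : MarginAssumption θ p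
  ambiguity : AmbiguityLevel θ ε p
  holder_Q : HolderClass θ.β θ.Cβ p.ηQ
  holder_P : HolderClass θ.βP θ.CβP p.ηP
  density_Q : StrongDensity θ p.Q.fst
  density_P : StrongDensity θ p.P.fst

/-! ### The two boundary conditions -/

/-- The signal transfer boundary (topological boundary in `ℝ^d`) is part of the decision
boundary. -/
structure BoundaryInDecisionBoundary {d : ℕ} (θ : NPParams) (p : Pair d) : Prop where
  continuousOn_Q : ContinuousOn p.ηQ p.Ω
  continuousOn_P : ContinuousOn p.ηP p.ΩP
  frontier_subset : frontier (p.strongSet θ.γ θ.Cγ) ⊆ {x ∈ p.Ω | p.ηQ x = 1 / 2}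

/-- Signal transfer boundary margin with exponent `αr ∈ [0, ∞]`, relative to the set `S`.
For `αr = ∞` the set `Ω⁺` is at distance at least `rm` from `S \ Ω⁺`. -/
def BoundaryMargin {d : ℕ} (θ : NPParams) (p : Pair d) (S : Set (Feature d))
    (αr : ℝ≥0∞) (rm Cr : ℝ) : Prop :=
  (αr ≠ ⊤ → ∀ r : ℝ, 0 < r → r < rm →
    p.Q.fst.real (p.nearWeak θ.γ θ.Cγ S r) ≤ Cr * r ^ αr.toReal) ∧
  (αr = ⊤ → ∀ x ∈ p.strongSet θ.γ θ.Cγ, ∀ y ∈ S \ p.strongSet θ.γ θ.Cγ, rm ≤ dist x y)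

/-! ### Tuning parameters, rates and the two conclusions -/

/-- `k_Q = ⌊c_Q n_Q^{2β/(2β+d)}⌋`. -/
def kQ (d : ℕ) (θ : NPParams) (cQ : ℝ) (nQ : ℕ) : ℕ :=
  ⌊cQ * (nQ : ℝ) ^ (2 * θ.β / (2 * θ.β + d))⌋₊

/-- `k_P = ⌊c_P n_P^{2γβ/(2γβ+d)}⌋`. -/
def kP (d : ℕ) (θ : NPParams) (cP : ℝ) (nP : ℕ) : ℕ :=
  ⌊cP * (nP : ℝ) ^ (2 * θ.γ * θ.β / (2 * θ.γ * θ.β + d))⌋₊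

/-- `n_P^{-β(1+α)/(2γβ+d)}`. -/
def sourceRate (d : ℕ) (θ : NPParams) (nP : ℕ) : ℝ :=
  (nP : ℝ) ^ (-(θ.β * (1 + θ.α) / (2 * θ.γ * θ.β + d)))

/-- `log^{1+α}(n_Q ∨ n_P) n_Q^{-β(1+α)/(2β+d)}`. -/
def targetRate (d : ℕ) (θ : NPParams) (nQ nP : ℕ) : ℝ :=
  Real.log (max nQ nP : ℕ) ^ (1 + θ.α) * (nQ : ℝ) ^ (-(θ.β * (1 + θ.α) / (2 * θ.β + d)))

/-- `ε_b ≤ C n_P^{-β(1+α)/(2γβ+d)}` for all source sample sizes `n_P ≥ N`. -/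
def BoundaryRiskBound {d : ℕ} (θ : NPParams) (cb : ℝ) (p : Pair d) (C : ℝ) (N : ℕ) : Prop :=
  ∀ nP : ℕ, N ≤ nP → p.boundaryRisk θ cb nP ≤ C * sourceRate d θ nP

/-- Upper bound, with constant `C`, on the expected excess risk of the TAB `K`-NN classifier for
all sample sizes `n_Q, n_P ≥ N` with
`n_Q^{d/(2β+d)} exp(-c_Q n_Q^{2β/(2β+d)}) ≤ A n_P^{-β(1+α)/(2γβ+d)}` and all thresholds `τ` with
`c₁ log(n_Q ∨ n_P) k_Q^{-1/2} ≤ τ ≤ c₂ log(n_Q ∨ n_P) k_Q^{-1/2}`. As `|η^Q - 1/2| ≤ 1/2`, the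
ambiguity level at `2τ > 1/2` is its value at `1/2`. -/
def TabRiskBound {d : ℕ} (θ : NPParams) (ε : ℝ → ℝ) (cQ cP A c₁ c₂ : ℝ) (p : Pair d)
    (C : ℝ) (N : ℕ) : Prop :=
  ∀ nQ nP : ℕ, N ≤ nQ → N ≤ nP →
    (nQ : ℝ) ^ ((d : ℝ) / (2 * θ.β + d)) *
        Real.exp (-(cQ * (nQ : ℝ) ^ (2 * θ.β / (2 * θ.β + d)))) ≤ A * sourceRate d θ nP →
    ∀ τ : ℝ,
      c₁ * (Real.log (max nQ nP : ℕ) * (kQ d θ cQ nQ : ℝ) ^ (-(1 / 2) : ℝ)) ≤ τ →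
      τ ≤ c₂ * (Real.log (max nQ nP : ℕ) * (kQ d θ cQ nQ : ℝ) ^ (-(1 / 2) : ℝ)) →
      Integrable
          (fun D => excessRisk p.Q p.ηQ (tabClassifier (kQ d θ cQ nQ) (kP d θ cP nP) τ D))
          (sampleLaw p.Q p.P nQ nP) ∧
        ∫ D, excessRisk p.Q p.ηQ (tabClassifier (kQ d θ cQ nQ) (kP d θ cP nP) τ D)
            ∂(sampleLaw p.Q p.P nQ nP) ≤
          C * (min (sourceRate d θ nP) (targetRate d θ nQ nP) + ε (min (2 * τ) (1 / 2)))

end TransferKNN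

end

namespace TransferKNN

/-! ### Ranks of the neighbours -/

section Rank

variable {d n : ℕ}

/-! Write u = |η^Q - 1/2|. The excess risk is the integral of 2u over the wrongly decided points, so
by Fubini the expected risk is governed by pointwise error probabilities. A wrong decision at x
forces either an error of at least τ in the target estimate, or u(x) ≤ 2τ together with a wrong
source vote (`tabClassifier_ne`).

The first event is negligible (`exists_target_tail`): τ exceeds the bias and the standard deviation
of the target estimate by a factor of order log, so Hoeffding's bound beats every power of the
sample sizes. The probability of finding too few target points nearby is what the sample-size
condition controls.

In the second event, points outside Ω⁺ cost at most ε(2τ ∧ 1/2) by definition of ε. Points of Ω⁺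
cost at most the target rate, because u ≤ 2τ and the margin assumption holds; it remains to bound
them by the source rate as well. If the source signal is at least κ u^γ on the whole ball that
contains the source neighbours, a wrong vote has probability at most exp(-c (u/b)^(2γ)) with b =
n_P^(-β/(2γβ+d)), up to a negligible term, and the margin assumption integrates u times this to
order b^(1+α) (`exists_lintegral_exp_margin_le`).

Hence all that matters is the risk carried by those points of Ω⁺ without a uniformly strong source
neighbourhood (`exists_tabRiskBound`). Let r be of order n_P^(-1/(2γβ+d)), the radius of the
neighbourhood. Points with u ≤ 2 C_β r^β carry risk of order r^(β(1+α)), the source rate. For larger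
u the Hölder condition on η^Q keeps the sign and half the margin on the ball, so the signal is
strong if the ball meets Ω_P only inside Ω⁺. If the ball leaves Ω⁺, the two hypotheses act
differently. Under the first, a segment leaving Ω⁺ crosses ∂Ω⁺, where η^Q = 1/2, so u ≤ C_β r^β and
the point was already counted. Under the second, the Hölder condition on η^P still gives a strong
signal once u^γ is a large multiple of r^(β_P); the remaining points have u of order at most
r^(β_P/γ) and mass of order at most r^(α_r), and the exponent condition makes the product at most of
the order of the source rate. The same estimates at radius c_b n_P^(-1/(2γβ+d)) bound ε_b directly.
-/

lemma neighborRank_lt (D : Fin n → Obs d) (x : Feature d) (i : Fin n) :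
    neighborRank D x i < n := by
  classical
  have h : neighborRank D x i < (Finset.univ : Finset (Fin n)).card := by
    unfold neighborRank
    refine Finset.card_lt_card ?_
    refine Finset.filter_ssubset.2 ⟨i, Finset.mem_univ _, by simp⟩
  simpa using h

lemma neighborRank_lt_neighborRank (D : Fin n → Obs d) (x : Feature d) {i j : Fin n}
    (h : dist (D j).1 x < dist (D i).1 x ∨ (dist (D j).1 x = dist (D i).1 x ∧ j < i)) :
    neighborRank D x j < neighborRank D x i := by
  classical
  unfold neighborRank
  refine Finset.card_lt_card (Finset.ssubset_iff_of_subset ?_ |>.2 ⟨j, by simpa using h, by simp⟩)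
  intro l hl
  simp only [Finset.mem_filter, Finset.mem_univ, true_and] at hl ⊢
  rcases h with h | h <;> rcases hl with hl | hl
  · exact Or.inl (hl.trans h)
  · exact Or.inl (hl.1 ▸ h)
  · exact Or.inl (h.1 ▸ hl)
  · exact Or.inr ⟨hl.1.trans h.1, hl.2.trans h.2⟩

/-- Distance with the index as tie-breaker is a strict total order on the sample, and the rank is
strictly monotone along it. -/
lemma neighborRank_injective (D : Fin n → Obs d) (x : Feature d) :
    Function.Injective (neighborRank D x) := by
  intro i j hij
  by_contra hne
  have key : (dist (D j).1 x < dist (D i).1 x ∨ (dist (D j).1 x = dist (D i).1 x ∧ j < i)) ∨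
      (dist (D i).1 x < dist (D j).1 x ∨ (dist (D i).1 x = dist (D j).1 x ∧ i < j)) := by
    rcases lt_trichotomy (dist (D j).1 x) (dist (D i).1 x) with h | h | h
    · exact Or.inl (Or.inl h)
    · rcases lt_or_gt_of_ne hne with h' | h'
      · exact Or.inr (Or.inr ⟨h.symm, h'⟩)
      · exact Or.inl (Or.inr ⟨h, h'⟩)
    · exact Or.inr (Or.inl h)
  rcases key with h | h
  · exact (neighborRank_lt_neighborRank D x h).ne hij.symm
  · exact (neighborRank_lt_neighborRank D x h).ne hij

open Classical in
/-- The indices of the `k` nearest neighbours of `x`. -/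
noncomputable def nearest (k : ℕ) (D : Fin n → Obs d) (x : Feature d) : Finset (Fin n) :=
  Finset.univ.filter fun i : Fin n => neighborRank D x i < k

lemma mem_nearest {k : ℕ} {D : Fin n → Obs d} {x : Feature d} {i : Fin n} :
    i ∈ nearest k D x ↔ neighborRank D x i < k := by
  simp [nearest]

/-- An injective self-map of a finite set is onto, so every rank below n is attained exactly once,
even when distances coincide. -/
lemma card_nearest {k : ℕ} (hk : k ≤ n) (D : Fin n → Obs d) (x : Feature d) :
    (nearest k D x).card = k := by
  classical
  have hinj := neighborRank_injective D x
  let f : Fin n → Fin n := fun i => ⟨neighborRank D x i, neighborRank_lt D x i⟩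
  have hf : Function.Injective f := fun i j h => hinj (by simpa [f] using h)
  have hs : Function.Surjective f := Finite.surjective_of_injective hf
  have himg : (nearest k D x).image (neighborRank D x) = Finset.range k := by
    ext m
    simp only [Finset.mem_image, mem_nearest, Finset.mem_range]
    constructor
    · rintro ⟨i, hi, rfl⟩; exact hi
    · intro hm
      obtain ⟨i, hi⟩ := hs ⟨m, hm.trans_le hk⟩
      have : neighborRank D x i = m := by simpa [f] using congrArg Fin.val hi
      exact ⟨i, by omega, this⟩
  rw [← Finset.card_image_of_injective _ hinj, himg, Finset.card_range]

lemma knnEstimate_eq (k : ℕ) (D : Fin n → Obs d) (x : Feature d) :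
    knnEstimate k D x = (k : ℝ)⁻¹ * ∑ i ∈ nearest k D x, labelValue (D i).2 := rfl

open Classical in
/-- If at least `k` sample points are within distance `r` of `x`, so are the `k` nearest ones. -/
lemma dist_le_of_mem_nearest {k : ℕ} {D : Fin n → Obs d} {x : Feature d} {r : ℝ}
    (h : k ≤ (Finset.univ.filter fun i : Fin n => (D i).1 ∈ Metric.closedBall x r).card)
    {i : Fin n} (hi : i ∈ nearest k D x) : (D i).1 ∈ Metric.closedBall x r := by
  by_contra hcon
  rw [mem_nearest] at hi
  refine absurd (h.trans ?_) (not_le.2 hi)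
  unfold neighborRank
  refine Finset.card_le_card ?_
  intro j hj
  simp only [Finset.mem_filter, Finset.mem_univ, true_and, Metric.mem_closedBall] at hj hcon ⊢
  exact Or.inl (by linarith [not_le.1 hcon])

end Rank

/-! ### Measurability -/

section Measurability

variable {d n : ℕ}

lemma measurable_labelValue : Measurable labelValue := measurable_of_finite _

/-- Joint measurability in the sample and the query point is what Fubini requires for the expected
risk. -/
lemma measurable_neighborRank (i : Fin n) :
    Measurable fun z : (Fin n → Obs d) × Feature d => neighborRank z.1 z.2 i := by
  classical
  unfold neighborRank
  simp only [Finset.card_filter]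
  refine Finset.measurable_sum _ fun j _ => Measurable.ite ?_ measurable_const measurable_const
  have hd : ∀ j : Fin n, Measurable fun z : (Fin n → Obs d) × Feature d => dist (z.1 j).1 z.2 := by
    intro j; fun_prop
  refine (measurableSet_lt (hd j) (hd i)).union ?_
  exact (measurableSet_eq_fun (hd j) (hd i)).inter (MeasurableSet.const _)

lemma measurable_knnEstimate (k : ℕ) :
    Measurable fun z : (Fin n → Obs d) × Feature d => knnEstimate k z.1 z.2 := by
  classical
  unfold knnEstimate
  simp only [Finset.sum_filter]
  refine Measurable.const_mul (Finset.measurable_sum _ fun i _ => ?_) _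
  refine Measurable.ite ?_ ?_ measurable_const
  · exact (measurable_neighborRank i) (measurableSet_Iio (a := k))
  · exact measurable_labelValue.comp (by fun_prop)

lemma measurable_plugIn {α : Type*} [MeasurableSpace α] {g : α → ℝ} (hg : Measurable g) :
    MeasurableSet {a | 1 / 2 ≤ g a} := measurableSet_le measurable_const hg

lemma measurable_tabClassifier {nQ nP : ℕ} (kQ kP : ℕ) (τ : ℝ) :
    Measurable fun z : ((Fin nQ → Obs d) × (Fin nP → Obs d)) × Feature d =>
      tabClassifier kQ kP τ z.1 z.2 := by
  have hQ : Measurable fun z : ((Fin nQ → Obs d) × (Fin nP → Obs d)) × Feature d =>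
      knnEstimate kQ z.1.1 z.2 :=
    (measurable_knnEstimate (d := d) (n := nQ) kQ).comp (f := fun z :
      ((Fin nQ → Obs d) × (Fin nP → Obs d)) × Feature d => (z.1.1, z.2)) (by fun_prop)
  have hP : Measurable fun z : ((Fin nQ → Obs d) × (Fin nP → Obs d)) × Feature d =>
      knnEstimate kP z.1.2 z.2 :=
    (measurable_knnEstimate (d := d) (n := nP) kP).comp (f := fun z :
      ((Fin nQ → Obs d) × (Fin nP → Obs d)) × Feature d => (z.1.2, z.2)) (by fun_prop)
  have hb : ∀ g : ((Fin nQ → Obs d) × (Fin nP → Obs d)) × Feature d → ℝ, Measurable g →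
      Measurable fun z => (decide (1 / 2 ≤ g z) : Bool) := fun g hg =>
    measurable_to_bool (by
      have : (fun z => (decide (1 / 2 ≤ g z) : Bool)) ⁻¹' {true} = {z | 1 / 2 ≤ g z} := by
        ext; simp
      rw [this]; exact measurable_plugIn hg)
  unfold tabClassifier plugIn
  refine Measurable.ite (measurableSet_le measurable_const ?_) ?_ ?_
  · exact (hQ.sub_const _).abs
  · convert hb _ hQ
  · convert hb _ hP

end Measurability

/-! ### Labels as coin flips -/

section Coupling

variable {d n : ℕ}

open Classical in
/-- A label with success probability `q`, as a function of a uniform random variable. -/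
noncomputable def coin (q : ℝ) (u : unitInterval) : Bool := decide ((u : ℝ) ≤ q)

lemma measurableSet_coin {α : Type*} [MeasurableSpace α] {g : α → ℝ} (hg : Measurable g) :
    Measurable fun z : α × unitInterval => coin (g z.1) z.2 := by
  refine measurable_to_bool ?_
  have : (fun z : α × unitInterval => coin (g z.1) z.2) ⁻¹' {true} =
      {z | ((z.2 : unitInterval) : ℝ) ≤ g z.1} := by
    ext; simp [coin]
  rw [this]
  exact measurableSet_le (by fun_prop) (by fun_prop)

lemma volume_coin_true {q : ℝ} (hq : q ∈ Icc (0 : ℝ) 1) :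
    volume {u : unitInterval | coin q u = true} = ENNReal.ofReal q := by
  have : {u : unitInterval | coin q u = true} = Set.Iic (⟨q, hq⟩ : unitInterval) := by
    ext u; simp [coin, ← Subtype.coe_le_coe]
  rw [this]
  simp [unitInterval.volume_Iic]

lemma integral_coin {q : ℝ} (hq : q ∈ Icc (0 : ℝ) 1) :
    ∫ u : unitInterval, labelValue (coin q u) = q := by
  have hm : MeasurableSet {u : unitInterval | coin q u = true} := by
    have : {u : unitInterval | coin q u = true} = Set.Iic (⟨q, hq⟩ : unitInterval) := by
      ext u; simp [coin, ← Subtype.coe_le_coe]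
    rw [this]; exact measurableSet_Iic
  have : (fun u : unitInterval => labelValue (coin q u)) =
      {u : unitInterval | coin q u = true}.indicator (fun _ => (1 : ℝ)) := by
    ext u; by_cases h : coin q u = true <;> simp [labelValue, h]
  rw [this, integral_indicator hm]
  simp [Measure.real, volume_coin_true hq, hq.1]

end Coupling

section Coupling

variable {d n : ℕ}

/-- Rectangles determine the measure, and the slice over `{false}` is the whole minus the slice over
`{true}`; the subtraction needs finiteness. -/
lemma measure_prod_bool_ext {α : Type*} [MeasurableSpace α] {μ ν : Measure (α × Bool)}
    [IsFiniteMeasure μ] [IsFiniteMeasure ν]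
    (h₁ : ∀ A, MeasurableSet A → μ (A ×ˢ {true}) = ν (A ×ˢ {true}))
    (h₂ : ∀ A, MeasurableSet A → μ (A ×ˢ univ) = ν (A ×ˢ univ)) : μ = ν := by
  refine Measure.ext_prod fun {A B} hA _ => ?_
  have hdiff : A ×ˢ ({false} : Set Bool) = A ×ˢ (univ : Set Bool) \ A ×ˢ {true} := by
    ext ⟨a, b⟩; cases b <;> simp
  have h₃ : μ (A ×ˢ {false}) = ν (A ×ˢ {false}) := by
    have hms : MeasurableSet (A ×ˢ ({true} : Set Bool)) := hA.prod (MeasurableSet.singleton _)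
    rw [hdiff, measure_sdiff (prod_mono_right (subset_univ _)) hms.nullMeasurableSet
        (measure_ne_top _ _),
      measure_sdiff (prod_mono_right (subset_univ _)) hms.nullMeasurableSet (measure_ne_top _ _),
      h₁ A hA, h₂ A hA]
  have hB : B = ∅ ∨ B = {true} ∨ B = {false} ∨ B = univ := by
    by_cases ht : true ∈ B <;> by_cases hf : false ∈ B
    · right; right; right; ext b; cases b <;> simp [ht, hf]
    · right; left; ext b; cases b <;> simp [ht, hf]
    · right; right; left; ext b; cases b <;> simp [ht, hf]
    · left; ext b; cases b <;> simp [ht, hf]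
  rcases hB with rfl | rfl | rfl | rfl
  · simp
  · exact h₁ A hA
  · exact h₃
  · exact h₂ A hA

lemma IsRegressionFunction.measure_eq {Q : Measure (Obs d)} [IsProbabilityMeasure Q]
    {η : Feature d → ℝ} (h : IsRegressionFunction Q η) {A : Set (Feature d)}
    (hA : MeasurableSet A) : Q (A ×ˢ {true}) = ∫⁻ x in A, ENNReal.ofReal (η x) ∂Q.fst := by
  have hint : Integrable η (Q.fst.restrict A) :=
    Integrable.of_mem_Icc 0 1 h.measurable.aemeasurable (ae_of_all _ h.mem_Icc)
  rw [← ofReal_integral_eq_lintegral_ofReal hint (ae_of_all _ fun x => (h.mem_Icc x).1),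
    ← h.integral_eq A hA, ofReal_measureReal]

lemma measurable_coin_pair {η : Feature d → ℝ} (hη : Measurable η) :
    Measurable fun z : Feature d × unitInterval => ((z.1, coin (η z.1) z.2) : Obs d) :=
  measurable_fst.prodMk (measurableSet_coin hη)

/-- Observations are obtained from their features by flipping coins. -/
lemma IsRegressionFunction.eq_map {Q : Measure (Obs d)} [IsProbabilityMeasure Q]
    {η : Feature d → ℝ} (h : IsRegressionFunction Q η) :
    Q = (Q.fst.prod (volume : Measure unitInterval)).map
      fun z => ((z.1, coin (η z.1) z.2) : Obs d) := by
  have hm := measurable_coin_pair h.measurable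
  have : IsProbabilityMeasure ((Q.fst.prod (volume : Measure unitInterval)).map
      fun z => ((z.1, coin (η z.1) z.2) : Obs d)) :=
    Measure.isProbabilityMeasure_map hm.aemeasurable
  refine measure_prod_bool_ext (fun A hA => ?_) (fun A hA => ?_)
  · rw [h.measure_eq hA, Measure.map_apply hm (hA.prod (MeasurableSet.singleton _)),
      Measure.prod_apply (hm (hA.prod (MeasurableSet.singleton _))), ← lintegral_indicator hA]
    refine lintegral_congr fun x => ?_
    by_cases hx : x ∈ A
    · simp only [hx, indicator_of_mem]
      rw [← volume_coin_true (h.mem_Icc x)]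
      congr 1; ext u; simp [hx]
    · have : Prod.mk x ⁻¹' ((fun z : Feature d × unitInterval =>
          ((z.1, coin (η z.1) z.2) : Obs d)) ⁻¹' A ×ˢ {true}) = ∅ := by
        ext u; simp [hx]
      rw [this, indicator_of_notMem hx, measure_empty]
  · rw [Measure.map_apply hm (hA.prod MeasurableSet.univ)]
    have : (fun z : Feature d × unitInterval => ((z.1, coin (η z.1) z.2) : Obs d)) ⁻¹'
        (A ×ˢ univ) = A ×ˢ univ := by ext; simp
    rw [this, Measure.prod_prod, measure_univ, mul_one, Measure.fst_apply hA]
    congr 1; ext; simp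

/-- A sample is obtained from the sample of its features by flipping independent coins. -/
lemma IsRegressionFunction.pi_eq_map {Q : Measure (Obs d)} [IsProbabilityMeasure Q]
    {η : Feature d → ℝ} (h : IsRegressionFunction Q η) (n : ℕ) :
    (Measure.pi fun _ : Fin n => Q) =
      ((Measure.pi fun _ : Fin n => Q.fst).prod
        (Measure.pi fun _ : Fin n => (volume : Measure unitInterval))).map
        fun z i => ((z.1 i, coin (η (z.1 i)) (z.2 i)) : Obs d) := by
  have hm := measurable_coin_pair h.measurable
  have h1 := (measurePreserving_arrowProdEquivProdArrow (Feature d) unitInterval (Fin n)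
    (fun _ => Q.fst) (fun _ => volume)).map_eq
  rw [← h1, Measure.map_map ?_ (MeasurableEquiv.measurable _)]
  · have : IsProbabilityMeasure ((Q.fst.prod (volume : Measure unitInterval)).map
      fun z => ((z.1, coin (η z.1) z.2) : Obs d)) :=
      Measure.isProbabilityMeasure_map hm.aemeasurable
    have h2 := Measure.pi_map_pi (ι := Fin n) (μ := fun _ => Q.fst.prod
      (volume : Measure unitInterval)) (f := fun _ z => ((z.1, coin (η z.1) z.2) : Obs d))
      (fun _ => hm.aemeasurable)
    rw [← h.eq_map] at h2
    rw [← h2]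
    rfl
  · refine measurable_pi_lambda _ fun i => ?_
    exact hm.comp (f := fun z : (Fin n → Feature d) × (Fin n → unitInterval) => (z.1 i, z.2 i))
      (by fun_prop)

end Coupling

/-! ### Concentration of the nearest neighbour estimate -/

section Tails

variable {d n : ℕ}

lemma measurable_coin_right (q : ℝ) : Measurable fun u : unitInterval => coin q u :=
  (measurableSet_coin (g := fun _ : Unit => q) measurable_const).comp
    (f := fun u : unitInterval => ((), u)) (by fun_prop)

/-- Hoeffding's inequality for independent coin flips. -/
lemma hoeffding_coin (q : Fin n → ℝ) (hq : ∀ i, q i ∈ Icc (0 : ℝ) 1) (s : Finset (Fin n))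
    {σ : ℝ} (hσ : σ = 1 ∨ σ = -1) {t : ℝ} (ht : 0 ≤ t) :
    (Measure.pi fun _ : Fin n => (volume : Measure unitInterval))
      {u | (s.card : ℝ) * t ≤ ∑ i ∈ s, σ * (labelValue (coin (q i) (u i)) - q i)} ≤
      ENNReal.ofReal (Real.exp (-(2 * s.card * t ^ 2))) := by
  have hmeas : ∀ i, Measurable fun u : unitInterval => labelValue (coin (q i) u) := fun i =>
    measurable_labelValue.comp (measurable_coin_right _)
  have hsub : ∀ i, ProbabilityTheory.HasSubgaussianMGF
      (fun u : Fin n → unitInterval => σ * (labelValue (coin (q i) (u i)) - q i))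
      ((‖(1 : ℝ) - 0‖₊ / 2) ^ 2) (Measure.pi fun _ : Fin n => (volume : Measure unitInterval)) := by
    intro i
    have h1 := ProbabilityTheory.hasSubgaussianMGF_of_mem_Icc
      (μ := Measure.pi fun _ : Fin n => (volume : Measure unitInterval)) (a := 0) (b := 1)
      (X := fun u : Fin n → unitInterval => labelValue (coin (q i) (u i)))
      ((hmeas i).comp (measurable_pi_apply i)).aemeasurable
      (ae_of_all _ fun u => by
        cases coin (q i) (u i) <;> simp [labelValue])
    have h2 : ∫ u : Fin n → unitInterval, labelValue (coin (q i) (u i))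
        ∂(Measure.pi fun _ : Fin n => (volume : Measure unitInterval)) = q i := by
      rw [integral_comp_eval (μ := fun _ : Fin n => (volume : Measure unitInterval))
        (f := fun u => labelValue (coin (q i) u)) (hmeas i).aestronglyMeasurable,
        integral_coin (hq i)]
    rw [h2] at h1
    rcases hσ with rfl | rfl
    · simpa using h1
    · have := h1.neg
      refine this.congr (ae_of_all _ fun u => ?_)
      simp
  have hind : ProbabilityTheory.iIndepFun
      (fun i (u : Fin n → unitInterval) => σ * (labelValue (coin (q i) (u i)) - q i))
      (Measure.pi fun _ : Fin n => (volume : Measure unitInterval)) :=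
    ProbabilityTheory.iIndepFun_pi
      (X := fun i (u : unitInterval) => σ * (labelValue (coin (q i) u) - q i))
      fun i => (((hmeas i).sub_const _).const_mul _).aemeasurable
  have h := ProbabilityTheory.HasSubgaussianMGF.measure_sum_ge_le_of_iIndepFun hind (s := s)
    (fun i _ => hsub i) (ε := s.card * t) (by positivity)
  rw [← ofReal_measureReal]
  refine ENNReal.ofReal_le_ofReal (h.trans (Real.exp_le_exp.2 ?_))
  -- Each centred label has variance proxy 1/4, so the exponent is (m t)^2 / (2 m / 4) = 2 m t^2
  -- with m the cardinality. For m = 0 the quotient is 0 by convention, which is the right value.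
  rcases Nat.eq_zero_or_pos s.card with h0 | h0
  · simp [h0]
  · have : (0 : ℝ) < s.card := by exact_mod_cast h0
    apply le_of_eq
    simp
    field_simp

/-- Deviation of the labels of the nearest neighbours from their conditional means. -/
lemma nearest_deviation {Q : Measure (Obs d)} [IsProbabilityMeasure Q]
    {η : Feature d → ℝ} (h : IsRegressionFunction Q η) {k : ℕ} (hk : k ≤ n) (x : Feature d)
    {σ : ℝ} (hσ : σ = 1 ∨ σ = -1) {t : ℝ} (ht : 0 ≤ t) :
    (Measure.pi fun _ : Fin n => Q)
      {D | (k : ℝ) * t ≤ ∑ i ∈ nearest k D x, σ * (labelValue (D i).2 - η (D i).1)} ≤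
      ENNReal.ofReal (Real.exp (-(2 * k * t ^ 2))) := by
  classical
  have hS : MeasurableSet {D : Fin n → Obs d |
      (k : ℝ) * t ≤ ∑ i ∈ nearest k D x, σ * (labelValue (D i).2 - η (D i).1)} := by
    refine measurableSet_le measurable_const ?_
    unfold nearest
    simp only [Finset.sum_filter]
    refine Finset.measurable_sum _ fun i _ => Measurable.ite ?_ ?_ measurable_const
    · exact (((measurable_neighborRank i).comp (f := fun D : Fin n → Obs d => (D, x))
        (by fun_prop))) (measurableSet_Iio (a := k))
    · have := h.measurable
      exact ((measurable_labelValue.comp (by fun_prop)).sub (this.comp (by fun_prop))).const_mul _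
  have hm : Measurable fun (z : (Fin n → Feature d) × (Fin n → unitInterval)) (i : Fin n) =>
      ((z.1 i, coin (η (z.1 i)) (z.2 i)) : Obs d) := by
    refine measurable_pi_lambda _ fun i => ?_
    exact (measurable_coin_pair h.measurable).comp
      (f := fun z : (Fin n → Feature d) × (Fin n → unitInterval) => (z.1 i, z.2 i)) (by fun_prop)
  rw [h.pi_eq_map n, Measure.map_apply hm hS, Measure.prod_apply (hm hS)]
  refine (lintegral_mono (g := fun _ => ENNReal.ofReal (Real.exp (-(2 * k * t ^ 2))))
    fun X => ?_).trans (by simp)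
  have hX := hoeffding_coin (fun i => η (X i)) (fun i => h.mem_Icc (X i))
    (nearest k (fun i => ((X i, true) : Obs d)) x) hσ ht
  rw [card_nearest hk] at hX
  exact hX

open Classical in
/-- Chernoff's bound for the lower tail of the number of sample points in a set. -/
lemma measure_card_lt_le {Q : Measure (Obs d)} [IsProbabilityMeasure Q] {B : Set (Feature d)}
    (hB : MeasurableSet B) (n k : ℕ) {T : ℝ} (hkT : (k : ℝ) ≤ T)
    (hT : 4 * T ≤ n * Q.fst.real B) :
    (Measure.pi fun _ : Fin n => Q)
      {D | (Finset.univ.filter fun i : Fin n => (D i).1 ∈ B).card < k} ≤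
      ENNReal.ofReal (Real.exp (-T)) := by
  set p := Q.fst.real B with hp
  have hp0 : 0 ≤ p := measureReal_nonneg
  -- Exponential moment at parameter -1: the product of the `f (D i)` is exp of minus the number of
  -- points in `B`, and its mean factorises by independence.
  set f : Obs d → ℝ := fun z => Real.exp (-(B.indicator 1 z.1)) with hf
  have hfm : Measurable f :=
    ((measurable_one.indicator hB).comp measurable_fst).neg.exp
  have hf01 : ∀ z, f z ∈ Icc (0 : ℝ) 1 := fun z => by
    refine ⟨(Real.exp_pos _).le, ?_⟩
    rw [hf, Real.exp_le_one_iff]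
    by_cases hz : z.1 ∈ B <;> simp [hz]
  have hfeq : ∀ z, f z = 1 - (1 - Real.exp (-1)) * (Prod.fst ⁻¹' B).indicator 1 z := fun z => by
    by_cases hz : z.1 ∈ B <;> simp [hf, hz]
  have hpf : p = Q.real (Prod.fst ⁻¹' B) := by
    simp [hp, Measure.real, Measure.fst_apply hB]
  have hfi : ∫ z, f z ∂Q = 1 - (1 - Real.exp (-1)) * p := by
    simp_rw [hfeq]
    rw [integral_sub (integrable_const _), integral_const_mul,
      integral_indicator_one (measurable_fst hB), hpf]
    · simp
    · exact ((integrable_const (1 : ℝ)).indicator (measurable_fst hB)).const_mul _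
  have hprod : ∀ D : Fin n → Obs d, ∏ i, f (D i) =
      Real.exp (-((Finset.univ.filter fun i : Fin n => (D i).1 ∈ B).card : ℝ)) := fun D => by
    rw [hf, ← Real.exp_sum, Finset.sum_neg_distrib, Finset.card_filter]
    congr 2
    push_cast
    exact Finset.sum_congr rfl fun i _ => by by_cases hz : (D i).1 ∈ B <;> simp [hz]
  have hI : ∫ D : Fin n → Obs d, ∏ i, f (D i) ∂(Measure.pi fun _ : Fin n => Q) =
      (1 - (1 - Real.exp (-1)) * p) ^ n := by
    rw [integral_fintype_prod_eq_prod (fun _ : Fin n => f)]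
    simp [hfi]
  have hprodm : Measurable fun D : Fin n → Obs d => ∏ i, f (D i) :=
    Finset.measurable_prod _ fun i _ => hfm.comp (measurable_pi_apply i)
  have hmk := mul_meas_ge_le_integral_of_nonneg
    (μ := Measure.pi fun _ : Fin n => Q) (f := fun D : Fin n → Obs d => ∏ i, f (D i))
    (ae_of_all _ fun D => Finset.prod_nonneg fun i _ => (hf01 _).1)
    (Integrable.of_mem_Icc 0 1 hprodm.aemeasurable (ae_of_all _ fun D =>
      ⟨Finset.prod_nonneg fun i _ => (hf01 _).1,
        Finset.prod_le_one (fun i _ => (hf01 _).1) fun i _ => (hf01 _).2⟩))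
    (Real.exp (-(k : ℝ)))
  rw [hI] at hmk
  have he : Real.exp (-1) ≤ 1 / 2 := by
    rw [Real.exp_neg, one_div]
    exact inv_anti₀ (by norm_num) (by linarith [Real.add_one_le_exp (1 : ℝ)])
  have hp1 : p ≤ 1 := measureReal_le_one
  have hpow : (1 - (1 - Real.exp (-1)) * p) ^ n ≤ Real.exp (-(n * p / 2)) := by
    have h1 : 1 - (1 - Real.exp (-1)) * p ≤ Real.exp (-(p / 2)) := by
      have := Real.add_one_le_exp (-(p / 2))
      nlinarith
    have h0 : 0 ≤ 1 - (1 - Real.exp (-1)) * p := by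
      nlinarith [Real.exp_pos (-1)]
    calc _ ≤ Real.exp (-(p / 2)) ^ n := pow_le_pow_left₀ h0 h1 n
      _ = _ := by rw [← Real.exp_nat_mul]; congr 1; ring
  have hsub : {D : Fin n → Obs d | (Finset.univ.filter fun i : Fin n => (D i).1 ∈ B).card < k} ⊆
      {D | Real.exp (-(k : ℝ)) ≤ ∏ i, f (D i)} := fun D hD => by
    simp only [mem_ofPred_eq] at hD ⊢
    rw [hprod, Real.exp_le_exp]
    have : (((Finset.univ.filter fun i : Fin n => (D i).1 ∈ B).card : ℕ) : ℝ) ≤ k := by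
      exact_mod_cast hD.le
    linarith
  rw [← ofReal_measureReal]
  refine ENNReal.ofReal_le_ofReal ((measureReal_mono hsub).trans ?_)
  -- The factor 4 in `hT` is spent here: n p / 2 ≥ 2 T ≥ k + T, so Markov's level exp(-k) can be
  -- split off with exp(-T) to spare.
  have h3 : Real.exp (-(k : ℝ)) * (Measure.pi fun _ : Fin n => Q).real
      {D | Real.exp (-(k : ℝ)) ≤ ∏ i, f (D i)} ≤ Real.exp (-(k : ℝ)) * Real.exp (-T) := by
    refine (hmk.trans hpow).trans ?_
    rw [← Real.exp_add, Real.exp_le_exp]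
    linarith
  exact le_of_mul_le_mul_left h3 (Real.exp_pos _)

/-- Tail bound for the nearest neighbour estimate at `x`, when the regression function is bounded
below (`σ = 1`) or above (`σ = -1`) by `L` near `x` on a set of full measure. -/
lemma knnEstimate_tail {Q : Measure (Obs d)} [IsProbabilityMeasure Q]
    {η : Feature d → ℝ} (h : IsRegressionFunction Q η) {k : ℕ} (hk0 : 0 < k) (hk : k ≤ n)
    {x : Feature d} {r T : ℝ} (hkT : (k : ℝ) ≤ T)
    (hT : 4 * T ≤ n * Q.fst.real (Metric.closedBall x r)) {S : Set (Feature d)}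
    (hS : ∀ᵐ y ∂Q.fst, y ∈ S) {σ : ℝ} (hσ : σ = 1 ∨ σ = -1) {L : ℝ}
    (hL : ∀ y ∈ Metric.closedBall x r ∩ S, σ * L ≤ σ * η y) {t : ℝ} (ht : 0 ≤ t) :
    (Measure.pi fun _ : Fin n => Q) {D | σ * (knnEstimate k D x - L) ≤ -t} ≤
      ENNReal.ofReal (Real.exp (-T) + Real.exp (-(2 * k * t ^ 2))) := by
  classical
  have hkr : (0 : ℝ) < k := by exact_mod_cast hk0
  have hσ' : (-σ) = 1 ∨ (-σ) = -1 := by rcases hσ with rfl | rfl <;> simp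
  have hae : ∀ᵐ D ∂(Measure.pi fun _ : Fin n => Q), ∀ i, (D i).1 ∈ S := by
    rw [ae_all_iff]
    intro i
    have h1 : ∀ᵐ z ∂Q, z.1 ∈ S := ae_of_ae_map measurable_fst.aemeasurable hS
    exact (Measure.quasiMeasurePreserving_eval (fun _ : Fin n => Q) i).ae h1
  -- If at least k points fall in the ball, all k neighbours lie there and almost surely in `S`, so
  -- their conditional means are on the good side of `L`. A bad estimate is then entirely due to the
  -- label noise.
  have hsub : ∀ᵐ D ∂(Measure.pi fun _ : Fin n => Q),
      D ∈ {D : Fin n → Obs d | σ * (knnEstimate k D x - L) ≤ -t} →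
      D ∈ {D : Fin n → Obs d |
          (Finset.univ.filter fun i : Fin n => (D i).1 ∈ Metric.closedBall x r).card < k} ∪
        {D | (k : ℝ) * t ≤ ∑ i ∈ nearest k D x, (-σ) * (labelValue (D i).2 - η (D i).1)} := by
    filter_upwards [hae] with D hD hbad
    by_cases hc : (Finset.univ.filter fun i : Fin n =>
        (D i).1 ∈ Metric.closedBall x r).card < k
    · exact Or.inl hc
    · right
      simp only [mem_ofPred_eq] at hbad ⊢
      have hsum : ∑ i ∈ nearest k D x, σ * L ≤ ∑ i ∈ nearest k D x, σ * η (D i).1 :=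
        Finset.sum_le_sum fun i hi =>
          hL _ ⟨dist_le_of_mem_nearest (not_lt.1 hc) hi, hD i⟩
      rw [Finset.sum_const, card_nearest hk, nsmul_eq_mul] at hsum
      have hest : (k : ℝ) * knnEstimate k D x = ∑ i ∈ nearest k D x, labelValue (D i).2 := by
        rw [knnEstimate_eq]; field_simp
      rw [← Finset.mul_sum, Finset.sum_sub_distrib, ← hest]
      rw [← Finset.mul_sum] at hsum
      nlinarith
  have hunion := (measure_mono_ae (Filter.eventually_iff_exists_mem.2
    ⟨_, hsub, fun D hD => hD⟩)).trans (measure_union_le _ _)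
  refine hunion.trans ?_
  rw [ENNReal.ofReal_add (Real.exp_pos _).le (Real.exp_pos _).le]
  exact add_le_add (measure_card_lt_le Metric.isClosed_closedBall.measurableSet n k hkT hT)
    (nearest_deviation h hk x hσ' ht)

end Tails

/-! ### Excess risk -/

section Risk

variable {d : ℕ}

lemma plugIn_eq_true {η : Feature d → ℝ} {x : Feature d} : plugIn η x = true ↔ 1 / 2 ≤ η x := by
  simp [plugIn]

lemma plugIn_eq_false {η : Feature d → ℝ} {x : Feature d} :
    plugIn η x = false ↔ η x < 1 / 2 := by
  simp [plugIn]

lemma measurable_plugIn_fun {η : Feature d → ℝ} (hη : Measurable η) : Measurable (plugIn η) := by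
  refine measurable_to_bool ?_
  have : plugIn η ⁻¹' {true} = {x | 1 / 2 ≤ η x} := by ext; simp [plugIn]
  rw [this]; exact measurable_plugIn hη

lemma IsRegressionFunction.misclassificationRate_eq {Q : Measure (Obs d)} [IsProbabilityMeasure Q]
    {η : Feature d → ℝ} (h : IsRegressionFunction Q η) {f : Feature d → Bool}
    (hf : Measurable f) :
    misclassificationRate Q f = ∫ x, (if f x = true then 1 - η x else η x) ∂Q.fst := by
  have hF : ∀ b, MeasurableSet (f ⁻¹' {b}) := fun b => hf (MeasurableSet.singleton b)
  have hηi : Integrable η Q.fst :=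
    Integrable.of_mem_Icc 0 1 h.measurable.aemeasurable (ae_of_all _ h.mem_Icc)
  have hset : {z : Obs d | z.2 ≠ f z.1} =
      (f ⁻¹' {false}) ×ˢ {true} ∪ (f ⁻¹' {true}) ×ˢ {false} := by
    ext ⟨x, y⟩; cases hy : y <;> cases hx : f x <;> simp [hx]
  have hdiff : (f ⁻¹' {true}) ×ˢ ({false} : Set Bool) =
      (Prod.fst ⁻¹' (f ⁻¹' {true})) \ (f ⁻¹' {true}) ×ˢ {true} := by
    ext ⟨a, b⟩; cases b <;> simp
  have hm : ∀ b c, MeasurableSet ((f ⁻¹' {b}) ×ˢ ({c} : Set Bool)) := fun b c =>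
    (hF b).prod (MeasurableSet.singleton c)
  have h1 : Q.real ((f ⁻¹' {true}) ×ˢ {false}) = ∫ x in f ⁻¹' {true}, (1 - η x) ∂Q.fst := by
    rw [hdiff, measureReal_sdiff _ (hm _ _), h.integral_eq _ (hF true),
      integral_sub (integrable_const _) hηi.integrableOn]
    · congr 1
      simp [Measure.real, Measure.fst_apply (hF true)]
    · rintro ⟨a, b⟩ hab; exact hab.1
  unfold misclassificationRate
  rw [hset, measureReal_union _ (hm _ _), h1, h.integral_eq _ (hF false), add_comm,
    ← integral_add_compl (hF true) (μ := Q.fst)]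
  · congr 1
    · refine setIntegral_congr_fun (hF true) fun x hx => ?_
      simp only [mem_preimage, mem_singleton_iff] at hx
      simp [hx]
    · have : (f ⁻¹' {true})ᶜ = f ⁻¹' {false} := by ext x; simp
      rw [this]
      refine setIntegral_congr_fun (hF false) fun x hx => ?_
      simp only [mem_preimage, mem_singleton_iff] at hx
      simp [hx]
  · refine Integrable.of_mem_Icc 0 1 (Measurable.ite (hF true)
      (measurable_const.sub h.measurable) h.measurable).aemeasurable (ae_of_all _ fun x => ?_)
    have := h.mem_Icc x
    split_ifs
    · exact ⟨by linarith [this.2], by linarith [this.1]⟩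
    · exact this
  · rw [Set.disjoint_left]
    rintro ⟨a, b⟩ ⟨_, hb⟩ ⟨_, hb'⟩
    simp_all

/-- The excess risk integrates `2 |η - 1/2|` over the points with a wrong decision. -/
lemma IsRegressionFunction.excessRisk_eq {Q : Measure (Obs d)} [IsProbabilityMeasure Q]
    {η : Feature d → ℝ} (h : IsRegressionFunction Q η) {f : Feature d → Bool}
    (hf : Measurable f) :
    excessRisk Q η f =
      ∫ x, (if f x ≠ plugIn η x then 2 * |η x - 1 / 2| else 0) ∂Q.fst := by
  have hint : ∀ g : Feature d → Bool, Measurable g →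
      Integrable (fun x => if g x = true then 1 - η x else η x) Q.fst := fun g hg => by
    refine Integrable.of_mem_Icc 0 1 (Measurable.ite (hg (MeasurableSet.singleton true))
      (measurable_const.sub h.measurable) h.measurable).aemeasurable (ae_of_all _ fun x => ?_)
    have := h.mem_Icc x
    split_ifs
    · exact ⟨by linarith [this.2], by linarith [this.1]⟩
    · exact this
  have hp := measurable_plugIn_fun h.measurable
  unfold excessRisk
  rw [h.misclassificationRate_eq hf, h.misclassificationRate_eq hp,
    ← integral_sub (hint f hf) (hint _ hp)]
  refine integral_congr_ae (ae_of_all _ fun x => ?_)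
  simp only
  rcases le_or_gt (1 / 2) (η x) with hx | hx
  · rw [plugIn_eq_true.2 hx, abs_of_nonneg (by linarith)]
    cases f x <;> simp; ring
  · rw [plugIn_eq_false.2 hx, abs_of_neg (by linarith)]
    cases f x <;> simp; ring

/-- Fubini bound for the expected excess risk of a random classifier. -/
lemma IsRegressionFunction.integral_excessRisk_le {Q : Measure (Obs d)} [IsProbabilityMeasure Q]
    {η : Feature d → ℝ} (h : IsRegressionFunction Q η) {Λ : Type*} [MeasurableSpace Λ]
    {law : Measure Λ} [IsProbabilityMeasure law] {F : Λ → Feature d → Bool}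
    (hF : Measurable fun z : Λ × Feature d => F z.1 z.2) {K : ℝ} (hK : 0 ≤ K)
    (hle : ∫⁻ x, ENNReal.ofReal (2 * |η x - 1 / 2|) * law {D | F D x ≠ plugIn η x} ∂Q.fst ≤
      ENNReal.ofReal K) :
    Integrable (fun D => excessRisk Q η (F D)) law ∧
      ∫ D, excessRisk Q η (F D) ∂law ≤ K := by
  have hFD : ∀ D, Measurable (F D) := fun D => hF.comp (measurable_const.prodMk measurable_id)
  set g : Λ × Feature d → ℝ :=
    fun z => if F z.1 z.2 ≠ plugIn η z.2 then 2 * |η z.2 - 1 / 2| else 0 with hg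
  have hp := measurable_plugIn_fun h.measurable
  have hset : MeasurableSet {z : Λ × Feature d | F z.1 z.2 ≠ plugIn η z.2} :=
    (measurableSet_eq_fun hF (hp.comp measurable_snd)).compl
  have hη := h.measurable
  have hgm : Measurable g := Measurable.ite hset
    (((hη.comp measurable_snd).sub_const _).abs.const_mul _) measurable_const
  have hg01 : ∀ z, g z ∈ Icc (0 : ℝ) 1 := fun z => by
    have h1 := h.mem_Icc z.2
    have h2 : |η z.2 - 1 / 2| ≤ 1 / 2 := abs_le.2 ⟨by linarith [h1.1], by linarith [h1.2]⟩
    simp only [hg]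
    split_ifs
    · exact ⟨by positivity, by linarith⟩
    · simp
  have hgi : Integrable g (law.prod Q.fst) :=
    Integrable.of_mem_Icc 0 1 hgm.aemeasurable (ae_of_all _ hg01)
  have hex : ∀ D, excessRisk Q η (F D) = ∫ x, g (D, x) ∂Q.fst := fun D =>
    h.excessRisk_eq (hFD D)
  simp_rw [hex]
  refine ⟨hgi.integral_prod_left, ?_⟩
  rw [← integral_prod _ hgi, integral_eq_lintegral_of_nonneg_ae (ae_of_all _ fun z => (hg01 z).1)
    hgm.aestronglyMeasurable, lintegral_prod_symm _ hgm.ennreal_ofReal.aemeasurable]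
  refine ENNReal.toReal_le_of_le_ofReal hK ((lintegral_mono fun x => le_of_eq ?_).trans hle)
  have hsx : MeasurableSet {D | F D x ≠ plugIn η x} :=
    hset.preimage (measurable_id.prodMk measurable_const : Measurable fun D : Λ => (D, x))
  rw [← lintegral_indicator_const hsx]
  refine lintegral_congr fun D => ?_
  by_cases hD : F D x = plugIn η x <;> simp [hg, hD]

end Risk

/-! ### Exponential moments under the margin assumption -/

section Peeling

/-- For T ≥ 1 compare T^m with a single term T^k / k! of the exponential series, k ≥ m; for T ≤ 1
the power is at most 1. -/
lemma exists_exp_neg_le_rpow {m : ℝ} (hm : 0 ≤ m) :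
    ∃ C : ℝ, 0 < C ∧ ∀ T : ℝ, 0 < T → Real.exp (-T) ≤ C * T ^ (-m) := by
  obtain ⟨k, hk⟩ := exists_nat_ge m
  refine ⟨k.factorial, by positivity, fun T hT => ?_⟩
  have hmain : T ^ m ≤ k.factorial * Real.exp T := by
    rcases le_total 1 T with h1 | h1
    · have h2 := Real.pow_div_factorial_le_exp T hT.le k
      rw [div_le_iff₀ (by positivity)] at h2
      calc T ^ m ≤ T ^ (k : ℝ) := Real.rpow_le_rpow_of_exponent_le h1 hk
        _ = T ^ k := Real.rpow_natCast _ _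
        _ ≤ _ := by linarith
    · calc T ^ m ≤ 1 := Real.rpow_le_one hT.le h1 hm
        _ ≤ 1 * 1 := by norm_num
        _ ≤ _ := mul_le_mul (by exact_mod_cast Nat.one_le_iff_ne_zero.2 k.factorial_ne_zero)
          (Real.one_le_exp hT.le) zero_le_one (by positivity)
  rw [Real.exp_neg, Real.rpow_neg hT.le, ← div_eq_mul_inv, ← one_div,
    div_le_div_iff₀ (Real.exp_pos _) (Real.rpow_pos_of_pos hT _)]
  linarith

/-- Dyadic bound for `v exp (-c v ^ s)`. -/
lemma exists_dyadic_bound {α c s : ℝ} (hα : 0 ≤ α) (hc : 0 < c) (hs : 0 < s) :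
    ∃ M : ℝ, 0 < M ∧ ∀ v : ℝ, 0 < v → ∃ j : ℕ, v ≤ 2 ^ j ∧
      v * Real.exp (-(c * v ^ s)) ≤ M * ((2 : ℝ) ^ j) ^ (-(1 + α)) := by
  -- With this exponent the exponential is at most a constant times v^(-(2+α)); the prefactor v
  -- consumes one power and leaves v^(-(1+α)).
  obtain ⟨C, hC, hexp⟩ := exists_exp_neg_le_rpow (m := (2 + α) / s) (by positivity)
  set M' := C * c ^ (-((2 + α) / s)) * 2 ^ (1 + α) with hM'
  have hM'0 : 0 < M' := by positivity
  refine ⟨max 1 M', by positivity, fun v hv => ?_⟩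
  rcases le_total v 1 with h1 | h1
  · refine ⟨0, by simpa using h1, ?_⟩
    simp only [pow_zero, Real.one_rpow, mul_one]
    calc v * Real.exp (-(c * v ^ s)) ≤ 1 * 1 :=
          mul_le_mul h1 (Real.exp_le_one_iff.2 (by rw [neg_nonpos]; positivity))
            (Real.exp_pos _).le zero_le_one
      _ ≤ _ := by simp
  · obtain ⟨n, hn1, hn2⟩ := exists_nat_pow_near h1 (one_lt_two)
    refine ⟨n + 1, hn2.le, ?_⟩
    have h2 := hexp (c * v ^ s) (by positivity)
    rw [Real.mul_rpow hc.le (by positivity), ← Real.rpow_mul hv.le] at h2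
    have hexpo : s * -((2 + α) / s) = -1 + -(1 + α) := by field_simp; ring
    rw [hexpo, Real.rpow_add hv, Real.rpow_neg_one] at h2
    have h3 : v ^ (-(1 + α)) ≤ 2 ^ (1 + α) * ((2 : ℝ) ^ (n + 1)) ^ (-(1 + α)) := by
      have h4 : v ^ (-(1 + α)) ≤ ((2 : ℝ) ^ n) ^ (-(1 + α)) :=
        Real.rpow_le_rpow_of_nonpos (by positivity) hn1 (by linarith)
      refine h4.trans (le_of_eq ?_)
      rw [pow_succ, Real.mul_rpow (by positivity) (by positivity), mul_left_comm,
        ← Real.rpow_add two_pos]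
      simp
    calc v * Real.exp (-(c * v ^ s))
        ≤ v * (C * (c ^ (-((2 + α) / s)) * (v⁻¹ * v ^ (-(1 + α))))) :=
          mul_le_mul_of_nonneg_left h2 hv.le
      _ = C * c ^ (-((2 + α) / s)) * v ^ (-(1 + α)) := by field_simp
      _ ≤ C * c ^ (-((2 + α) / s)) * (2 ^ (1 + α) * ((2 : ℝ) ^ (n + 1)) ^ (-(1 + α))) :=
          mul_le_mul_of_nonneg_left h3 (by positivity)
      _ = M' * ((2 : ℝ) ^ (n + 1)) ^ (-(1 + α)) := by rw [hM']; ring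
      _ ≤ _ := mul_le_mul_of_nonneg_right (le_max_right _ _) (by positivity)

/-- Integrals of `u exp (-c (u / b) ^ s)` under a margin condition of exponent `α`. -/
lemma exists_lintegral_exp_margin_le {α Cα c s : ℝ} (hα : 0 ≤ α) (hCα : 0 < Cα) (hc : 0 < c)
    (hs : 0 < s) :
    ∃ K : ℝ, 0 < K ∧ ∀ {X : Type} [MeasurableSpace X] (ν : Measure X) (u : X → ℝ),
      Measurable u → (∀ x, 0 ≤ u x) →
      (∀ t : ℝ, 0 < t → ν {x | 0 < u x ∧ u x ≤ t} ≤ ENNReal.ofReal (Cα * t ^ α)) →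
      ∀ b : ℝ, 0 < b →
        ∫⁻ x, ENNReal.ofReal (u x * Real.exp (-(c * (u x / b) ^ s))) ∂ν ≤
          ENNReal.ofReal (K * b ^ (1 + α)) := by
  obtain ⟨M, hM, hdy⟩ := exists_dyadic_bound hα hc hs
  refine ⟨M * Cα * 2, by positivity, ?_⟩
  intro X _ ν u hu hu0 hmargin b hb
  set w : ℕ → ℝ := fun j => b * (M * ((2 : ℝ) ^ j) ^ (-(1 + α))) with hw
  have hw0 : ∀ j, 0 ≤ w j := fun j => by positivity
  -- Sublevel sets are enough, dyadic shells are not needed: each point uses one summand, and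
  -- overlaps only enlarge the upper bound.
  set A : ℕ → Set X := fun j => {x | 0 < u x ∧ u x ≤ 2 ^ j * b} with hA
  have hAm : ∀ j, MeasurableSet (A j) := fun j =>
    (measurableSet_lt measurable_const hu).inter (measurableSet_le hu measurable_const)
  have hpt : ∀ x, ENNReal.ofReal (u x * Real.exp (-(c * (u x / b) ^ s))) ≤
      ∑' j, (A j).indicator (fun _ => ENNReal.ofReal (w j)) x := fun x => by
    rcases (hu0 x).eq_or_lt with h0 | h0
    · simp [← h0]
    · obtain ⟨j, hj1, hj2⟩ := hdy (u x / b) (by positivity)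
      rw [div_le_iff₀ hb] at hj1
      have hx : x ∈ A j := ⟨h0, hj1⟩
      refine le_trans ?_ (ENNReal.le_tsum j)
      rw [indicator_of_mem hx]
      refine ENNReal.ofReal_le_ofReal ?_
      have := mul_le_mul_of_nonneg_left hj2 hb.le
      rw [← mul_assoc, mul_div_cancel₀ _ hb.ne'] at this
      exact this
  refine (lintegral_mono hpt).trans ?_
  rw [lintegral_tsum fun j => (measurable_const.indicator (hAm j)).aemeasurable]
  have hterm : ∀ j, ∫⁻ x, (A j).indicator (fun _ => ENNReal.ofReal (w j)) x ∂ν ≤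
      ENNReal.ofReal (M * Cα * b ^ (1 + α)) * ENNReal.ofReal ((1 / 2) ^ j) := fun j => by
    rw [lintegral_indicator_const (hAm j), ← ENNReal.ofReal_mul (by positivity)]
    refine (mul_le_mul_right (hmargin _ (by positivity)) _).trans ?_
    rw [← ENNReal.ofReal_mul (hw0 j)]
    refine ENNReal.ofReal_le_ofReal (le_of_eq ?_)
    -- The margin mass grows like 2^(jα) while the weight decays like 2^(-j(1+α)), which leaves a
    -- geometric series of ratio 1/2.
    have e1 : ((2 : ℝ) ^ j) ^ (-(1 + α)) * ((2 : ℝ) ^ j) ^ α = (1 / 2) ^ j := by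
      rw [← Real.rpow_add (by positivity)]
      have : -(1 + α) + α = -1 := by ring
      rw [this, Real.rpow_neg_one, one_div, inv_pow]
    have e2 : b ^ (1 + α) = b * b ^ α := by rw [Real.rpow_add hb, Real.rpow_one]
    rw [hw, Real.mul_rpow (by positivity) hb.le, e2, ← e1]
    ring
  refine (ENNReal.tsum_le_tsum hterm).trans ?_
  rw [ENNReal.tsum_mul_left, ← ENNReal.ofReal_tsum_of_nonneg (fun j => by positivity)
    summable_geometric_two, tsum_geometric_two, ← ENNReal.ofReal_mul (by positivity)]
  refine ENNReal.ofReal_le_ofReal (le_of_eq (by ring))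

end Peeling

/-! ### Mass of small balls -/

section Mass

variable {d : ℕ}

/-- Volume of the unit ball. -/
noncomputable def unitBallVolume (d : ℕ) : ℝ := volume.real (Metric.closedBall (0 : Feature d) 1)

lemma unitBallVolume_pos (d : ℕ) : 0 < unitBallVolume d :=
  ENNReal.toReal_pos (Metric.measure_closedBall_pos volume _ one_pos).ne'
    measure_closedBall_lt_top.ne

lemma volume_real_closedBall (x : Feature d) {r : ℝ} (hr : 0 ≤ r) :
    volume.real (Metric.closedBall x r) = r ^ d * unitBallVolume d := by
  rw [unitBallVolume, Measure.addHaar_real_closedBall' volume x hr, finrank_euclideanSpace,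
    Fintype.card_fin]

lemma StrongDensity.le_measure_closedBall {θ : NPParams} (hθ : θ.Valid) {ν : Measure (Feature d)}
    [IsProbabilityMeasure ν] (h : StrongDensity θ ν) {x : Feature d} (hx : x ∈ ν.support) {r : ℝ}
    (hr : 0 < r) (hr' : r < θ.rμ) :
    θ.μlo * (θ.cμ * (r ^ d * unitBallVolume d)) ≤ ν.real (Metric.closedBall x r) := by
  have hlo := hθ.μlo_pos
  have hv : 0 < volume.real (Metric.closedBall x r) := by
    rw [volume_real_closedBall x hr.le]; have := unitBallVolume_pos d; positivity
  have h1 := h.ball_le x hx r hr hr'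
  rw [le_div_iff₀ hv, volume_real_closedBall x hr.le] at h1
  have hSm : MeasurableSet ν.support := Measure.isClosed_support.measurableSet
  set G := Metric.closedBall x r ∩ ν.support with hG
  have hGm : MeasurableSet G := Metric.isClosed_closedBall.measurableSet.inter hSm
  have hGfin : volume G ≠ ∞ := (measure_mono inter_subset_left).trans_lt
    measure_closedBall_lt_top |>.ne
  have h2 : ENNReal.ofReal θ.μlo * volume G ≤ ν G := by
    conv_rhs => rw [← Measure.withDensity_rnDeriv_eq ν volume h.absolutelyContinuous]
    rw [withDensity_apply _ hGm, ← setLIntegral_const]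
    refine lintegral_mono_ae ?_
    have h3 : ∀ᵐ y ∂volume.restrict G, (ν.rnDeriv volume y).toReal ∈ Icc θ.μlo θ.μhi :=
      ae_restrict_of_ae_restrict_of_subset inter_subset_right h.density_mem
    filter_upwards [h3] with y hy
    refine (ENNReal.ofReal_le_ofReal hy.1).trans ENNReal.ofReal_toReal_le
  have h4 : θ.μlo * volume.real G ≤ ν.real G := by
    have := ENNReal.toReal_mono (measure_ne_top ν G) h2
    rwa [ENNReal.toReal_mul, ENNReal.toReal_ofReal hlo.le] at this
  calc _ ≤ θ.μlo * volume.real G := mul_le_mul_of_nonneg_left h1 hlo.le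
    _ ≤ ν.real G := h4
    _ ≤ _ := measureReal_mono inter_subset_left

/-- The factor of the radius within which the nearest neighbours are found. -/
noncomputable def ballConst (d : ℕ) (θ : NPParams) (c : ℝ) : ℝ :=
  (4 * c / (θ.μlo * (θ.cμ * unitBallVolume d))) ^ (1 / (d : ℝ))

lemma ballConst_pos {θ : NPParams} (hθ : θ.Valid) {c : ℝ} (hc : 0 < c) : 0 < ballConst d θ c := by
  have := hθ.μlo_pos
  have := hθ.cμ_pos
  have := unitBallVolume_pos d
  unfold ballConst
  positivity

/-- `ballConst` is the constant that turns the lower bound on the mass into an equality with the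
left side, since n · n^(-d/(2δ+d)) = n^(2δ/(2δ+d)). The 4 is the one in `measure_card_lt_le`. -/
lemma StrongDensity.le_mul_measure_closedBall (hd : 0 < d) {θ : NPParams} (hθ : θ.Valid)
    {ν : Measure (Feature d)} [IsProbabilityMeasure ν] (h : StrongDensity θ ν) {x : Feature d}
    (hx : x ∈ ν.support) {c δ : ℝ} (hc : 0 < c) (hδ : 0 ≤ δ) {n : ℕ} (hn : 1 ≤ n)
    (hr : ballConst d θ c * (n : ℝ) ^ (-(1 / (2 * δ + d))) < θ.rμ) :
    4 * (c * (n : ℝ) ^ (2 * δ / (2 * δ + d))) ≤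
      n * ν.real (Metric.closedBall x (ballConst d θ c * (n : ℝ) ^ (-(1 / (2 * δ + d))))) := by
  have hn0 : (0 : ℝ) < n := by exact_mod_cast hn
  have hd0 : (0 : ℝ) < d := by exact_mod_cast hd
  have hC := ballConst_pos (d := d) hθ hc
  have h1 := h.le_measure_closedBall hθ hx (by positivity) hr
  have hlo := hθ.μlo_pos
  have hcμ := hθ.cμ_pos
  have hv := unitBallVolume_pos d
  refine le_trans (le_of_eq ?_) (mul_le_mul_of_nonneg_left h1 hn0.le)
  have e1 : ballConst d θ c ^ d = 4 * c / (θ.μlo * (θ.cμ * unitBallVolume d)) := by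
    rw [ballConst, ← Real.rpow_natCast, ← Real.rpow_mul (by positivity), one_div,
      inv_mul_cancel₀ hd0.ne', Real.rpow_one]
  have e2 : (n : ℝ) * ((n : ℝ) ^ (-(1 / (2 * δ + d)))) ^ d = (n : ℝ) ^ (2 * δ / (2 * δ + d)) := by
    rw [← Real.rpow_natCast, ← Real.rpow_mul hn0.le]
    conv_lhs => rw [← Real.rpow_one (n : ℝ), ← Real.rpow_mul hn0.le, ← Real.rpow_add hn0]
    congr 1
    field_simp
    ring
  rw [← e2, mul_pow, e1]
  field_simp

end Mass

/-! ### Sample sizes -/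

section Sizes

variable {d : ℕ}

lemma tendsto_natCast_rpow_atTop {s : ℝ} (hs : 0 < s) :
    Filter.Tendsto (fun n : ℕ => (n : ℝ) ^ s) Filter.atTop Filter.atTop :=
  (tendsto_rpow_atTop hs).comp tendsto_natCast_atTop_atTop

/-- Properties of the number of neighbours `⌊c n ^ (2δ / (2δ + d))⌋` for large `n`. -/
structure GoodSize (d : ℕ) (θ : NPParams) (c δ : ℝ) (n : ℕ) : Prop where
  one_le : 1 ≤ n
  two_le : 2 ≤ c * (n : ℝ) ^ (2 * δ / (2 * δ + d))
  floor_le : ⌊c * (n : ℝ) ^ (2 * δ / (2 * δ + d))⌋₊ ≤ n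
  radius_lt : ballConst d θ c * (n : ℝ) ^ (-(1 / (2 * δ + d))) < θ.rμ

lemma eventually_rpow_neg_lt {s : ℝ} (hs : 0 < s) (C : ℝ) {r : ℝ} (hr : 0 < r) :
    ∀ᶠ n : ℕ in Filter.atTop, C * (n : ℝ) ^ (-s) < r := by
  have h : Filter.Tendsto (fun n : ℕ => C * (n : ℝ) ^ (-s)) Filter.atTop (nhds (C * 0)) :=
    ((tendsto_rpow_neg_atTop hs).comp tendsto_natCast_atTop_atTop).const_mul C
  rw [mul_zero] at h
  exact h.eventually (gt_mem_nhds hr)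

lemma eventually_goodSize (hd : 0 < d) {θ : NPParams} (hθ : θ.Valid) {c δ : ℝ} (hc : 0 < c)
    (hδ : 0 < δ) : ∀ᶠ n : ℕ in Filter.atTop, GoodSize d θ c δ n := by
  have hd0 : (0 : ℝ) < d := by exact_mod_cast hd
  have he : 0 < 2 * δ + d := by positivity
  have h2 := ((tendsto_natCast_rpow_atTop (s := 2 * δ / (2 * δ + d))
    (by positivity)).const_mul_atTop hc).eventually_ge_atTop 2
  have h3 := eventually_rpow_neg_lt (s := d / (2 * δ + d)) (by positivity) c one_pos
  have h4 := eventually_rpow_neg_lt (s := 1 / (2 * δ + d)) (by positivity) (ballConst d θ c)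
    hθ.rμ_pos
  filter_upwards [h2, h3, h4, Filter.eventually_ge_atTop 1] with n h2 h3 h4 h1
  refine ⟨h1, h2, ?_, h4⟩
  have hn0 : (0 : ℝ) < n := by exact_mod_cast h1
  refine Nat.floor_le_of_le ?_
  -- The exponent is 1 minus d/(2δ+d), so the number of neighbours is at most n once c n^(-d/(2δ+d))
  -- < 1.
  have e : 2 * δ / (2 * δ + d) = 1 + -(d / (2 * δ + d)) := by field_simp; ring
  rw [e, Real.rpow_add hn0, Real.rpow_one]
  nlinarith

lemma GoodSize.floor_pos {θ : NPParams} {c δ : ℝ} {n : ℕ} (h : GoodSize d θ c δ n) :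
    0 < ⌊c * (n : ℝ) ^ (2 * δ / (2 * δ + d))⌋₊ :=
  Nat.floor_pos.2 (one_le_two.trans h.two_le)

lemma GoodSize.le_floor {θ : NPParams} {c δ : ℝ} {n : ℕ} (h : GoodSize d θ c δ n) :
    c * (n : ℝ) ^ (2 * δ / (2 * δ + d)) / 2 ≤ ⌊c * (n : ℝ) ^ (2 * δ / (2 * δ + d))⌋₊ := by
  have := Nat.lt_floor_add_one (c * (n : ℝ) ^ (2 * δ / (2 * δ + d)))
  linarith [h.two_le]

lemma GoodSize.floor_le_self {θ : NPParams} {c δ : ℝ} {n : ℕ} (h : GoodSize d θ c δ n) :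
    (⌊c * (n : ℝ) ^ (2 * δ / (2 * δ + d))⌋₊ : ℝ) ≤ c * (n : ℝ) ^ (2 * δ / (2 * δ + d)) :=
  Nat.floor_le (by linarith [h.two_le])

/-- Tail bound for the nearest neighbour estimate with `⌊c n ^ (2δ / (2δ + d))⌋` neighbours. -/
lemma GoodSize.knnEstimate_tail (hd : 0 < d) {θ : NPParams} (hθ : θ.Valid) {Q : Measure (Obs d)}
    [IsProbabilityMeasure Q] {η : Feature d → ℝ} (h : IsRegressionFunction Q η)
    (hden : StrongDensity θ Q.fst) {x : Feature d} (hx : x ∈ Q.fst.support)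
    {c δ : ℝ} (hc : 0 < c) (hδ : 0 ≤ δ) {n : ℕ} (hn : GoodSize d θ c δ n)
    {σ : ℝ} (hσ : σ = 1 ∨ σ = -1) {L : ℝ}
    (hL : ∀ y ∈ Metric.closedBall x (ballConst d θ c * (n : ℝ) ^ (-(1 / (2 * δ + d)))) ∩
      Q.fst.support, σ * L ≤ σ * η y) {t : ℝ} (ht : 0 ≤ t) :
    (Measure.pi fun _ : Fin n => Q)
      {D | σ * (knnEstimate ⌊c * (n : ℝ) ^ (2 * δ / (2 * δ + d))⌋₊ D x - L) ≤ -t} ≤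
      ENNReal.ofReal (Real.exp (-(c * (n : ℝ) ^ (2 * δ / (2 * δ + d)))) +
        Real.exp (-(2 * ⌊c * (n : ℝ) ^ (2 * δ / (2 * δ + d))⌋₊ * t ^ 2))) :=
  TransferKNN.knnEstimate_tail h hn.floor_pos hn.floor_le hn.floor_le_self
    (hden.le_mul_measure_closedBall hd hθ hx hc hδ hn.one_le hn.radius_lt)
    Measure.support_mem_ae hσ hL ht

end Sizes

/-! ### The target estimate -/

section Target

variable {d : ℕ}

lemma eventually_le_log (K : ℝ) : ∀ᶠ n : ℕ in Filter.atTop, K ≤ Real.log n :=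
  (Real.tendsto_log_atTop.comp tendsto_natCast_atTop_atTop).eventually_ge_atTop K

lemma log_le_log_max_left {m n : ℕ} (hm : 1 ≤ m) : Real.log m ≤ Real.log (max m n : ℕ) :=
  Real.log_le_log (by exact_mod_cast hm) (by exact_mod_cast le_max_left m n)

lemma log_le_log_max_right {m n : ℕ} (hn : 1 ≤ n) : Real.log n ≤ Real.log (max m n : ℕ) :=
  Real.log_le_log (by exact_mod_cast hn) (by exact_mod_cast le_max_right m n)

lemma exp_neg_mul_le_rpow {n : ℕ} (hn : 1 ≤ n) {K K' L : ℝ} (hK' : 0 ≤ K') (hK : K' ≤ K)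
    (hL : Real.log n ≤ L) : Real.exp (-(K * L)) ≤ (n : ℝ) ^ (-K') := by
  have hn0 : (0 : ℝ) < n := by exact_mod_cast hn
  have hl0 : 0 ≤ Real.log n := Real.log_natCast_nonneg n
  rw [Real.rpow_def_of_pos hn0, Real.exp_le_exp]
  nlinarith

lemma HolderClass.abs_sub_le {β C : ℝ} {g : Feature d → ℝ} (h : HolderClass β C g) (hβ : 0 ≤ β)
    (hC : 0 ≤ C) {x y : Feature d} {r : ℝ} (hy : y ∈ Metric.closedBall x r) :
    |g y - g x| ≤ C * r ^ β := by
  refine (h y x).trans (mul_le_mul_of_nonneg_left (Real.rpow_le_rpow (norm_nonneg _) ?_ hβ) hC)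
  rwa [← dist_eq_norm]

lemma rpow_le_targetRate {θ : NPParams} (hθ : θ.Valid) {nQ nP : ℕ}
    (hL : 1 ≤ Real.log (max nQ nP : ℕ)) :
    (nQ : ℝ) ^ (-(θ.β * (1 + θ.α) / (2 * θ.β + d))) ≤ targetRate d θ nQ nP := by
  have := hθ.α_nonneg
  exact le_mul_of_one_le_left (by positivity) (Real.one_le_rpow hL (by linarith))

/-- The threshold is a factor c₁ L above k^(-1/2), so Hoeffding's exponent is at least c₁² L² / 2;
being quadratic in the logarithm `L`, it beats κ L for any fixed κ once `L` is large. -/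
lemma exp_neg_threshold_le {k c₁ L τ κ : ℝ} (hk : 0 < k) (hc₁ : 0 < c₁) (hL : 0 ≤ L)
    (hτ : c₁ * (L * k ^ (-(1 / 2) : ℝ)) ≤ τ) (hκ : 2 * κ ≤ c₁ ^ 2 * L) :
    Real.exp (-(2 * k * (τ / 2) ^ 2)) ≤ Real.exp (-(κ * L)) := by
  rw [Real.exp_le_exp, neg_le_neg_iff]
  have h2 : (c₁ * (L * k ^ (-(1 / 2) : ℝ))) ^ 2 ≤ τ ^ 2 := pow_le_pow_left₀ (by positivity) hτ 2
  have h3 : k * (k ^ (-(1 / 2) : ℝ)) ^ 2 = 1 := by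
    rw [← Real.rpow_natCast, ← Real.rpow_mul hk.le]
    norm_num
    rw [Real.rpow_neg_one, mul_inv_cancel₀ hk.ne']
  have h4 : c₁ ^ 2 * L ^ 2 ≤ k * τ ^ 2 := by
    calc c₁ ^ 2 * L ^ 2 = c₁ ^ 2 * L ^ 2 * (k * (k ^ (-(1 / 2) : ℝ)) ^ 2) := by rw [h3, mul_one]
      _ = k * (c₁ * (L * k ^ (-(1 / 2) : ℝ))) ^ 2 := by ring
      _ ≤ _ := mul_le_mul_of_nonneg_left h2 hk.le
  nlinarith

/-- The Hölder bias over the neighbourhood and k^(-1/2) balance at n^(-β/e), so the logarithm in the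
threshold absorbs the constants. -/
lemma bias_le_threshold {c c₁ L n β e H R k τ : ℝ} (hc : 0 < c) (hc₁ : 0 < c₁) (hL : 0 ≤ L)
    (hn : 0 < n) (hR : 0 ≤ R) (he : 0 < e) (hk : 0 < k)
    (hkT : k ≤ c * n ^ (2 * β / e)) (hl : 2 * (H * R ^ β) * c ^ (1 / 2 : ℝ) / c₁ ≤ L)
    (hτ : c₁ * (L * k ^ (-(1 / 2) : ℝ)) ≤ τ) :
    H * (R * n ^ (-(1 / e))) ^ β ≤ τ / 2 := by
  have h1 : (c * n ^ (2 * β / e)) ^ (-(1 / 2) : ℝ) ≤ k ^ (-(1 / 2) : ℝ) :=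
    Real.rpow_le_rpow_of_nonpos hk hkT (by norm_num)
  have e1 : 2 * β / e * (-(1 / 2)) = -(1 / e) * β := by field_simp
  rw [Real.mul_rpow hc.le (by positivity), ← Real.rpow_mul hn.le, e1, Real.rpow_neg hc.le] at h1
  rw [Real.mul_rpow hR (by positivity), ← Real.rpow_mul hn.le]
  rw [div_le_iff₀ hc₁] at hl
  have hs : 0 < c ^ (1 / 2 : ℝ) := by positivity
  have hm : 0 < n ^ (-(1 / e) * β) := by positivity
  have h3 : c₁ * (L * ((c ^ (1 / 2 : ℝ))⁻¹ * n ^ (-(1 / e) * β))) ≤ τ :=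
    le_trans (by gcongr) hτ
  have h4 : 2 * (H * R ^ β) ≤ c₁ * L * (c ^ (1 / 2 : ℝ))⁻¹ := by
    rw [← div_eq_mul_inv, le_div_iff₀ hs]; linarith
  nlinarith [mul_le_mul_of_nonneg_right h4 hm.le]

lemma add_le_mul_min {a b s t A C : ℝ} (hs : 0 ≤ s) (ht : 0 ≤ t) (hA : 0 ≤ A) (hC : 0 ≤ C)
    (h₁ : a ≤ A * s) (h₂ : a ≤ C * t) (h₃ : b ≤ s) (h₄ : b ≤ t) :
    a + b ≤ (A + C + 1) * min s t := by
  rw [mul_min_of_nonneg _ _ (by positivity), le_min_iff]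
  have := mul_nonneg hC hs
  have := mul_nonneg hA ht
  constructor <;> linarith

/-- The threshold dominates the error of the target estimate, up to a small probability. -/
lemma exists_target_tail (hd : 0 < d) {θ : NPParams} (hθ : θ.Valid) (hβ : 0 < θ.β)
    {cQ A c₁ : ℝ} (hcQ : 0 < cQ) (hA : 0 < A) (hc₁ : 0 < c₁) :
    ∃ (K : ℝ) (N : ℕ), 0 < K ∧ ∀ (ε : ℝ → ℝ) (p : Pair d), InClassNP θ ε p →
      ∀ nQ nP : ℕ, N ≤ nQ → N ≤ nP →
      (nQ : ℝ) ^ ((d : ℝ) / (2 * θ.β + d)) *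
        Real.exp (-(cQ * (nQ : ℝ) ^ (2 * θ.β / (2 * θ.β + d)))) ≤ A * sourceRate d θ nP →
      ∀ τ : ℝ,
      c₁ * (Real.log (max nQ nP : ℕ) * (kQ d θ cQ nQ : ℝ) ^ (-(1 / 2) : ℝ)) ≤ τ →
      0 < τ ∧ ∀ x ∈ p.Ω, (Measure.pi fun _ : Fin nQ => p.Q)
        {D | τ ≤ |knnEstimate (kQ d θ cQ nQ) D x - p.ηQ x|} ≤
        ENNReal.ofReal (K * min (sourceRate d θ nP) (targetRate d θ nQ nP)) := by
  have hα := hθ.α_nonneg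
  have hγ := hθ.γ_pos
  have hCβ := hθ.Cβ_pos
  have hd0 : (0 : ℝ) < d := by exact_mod_cast hd
  set e := 2 * θ.β + d with he
  have he0 : 0 < e := by positivity
  obtain ⟨C, hC, hexp⟩ := exists_exp_neg_le_rpow (m := (1 + θ.α) / 2) (by positivity)
  set C' := C * cQ ^ (-((1 + θ.α) / 2)) with hC'
  have hC'0 : 0 < C' := by positivity
  set C₁ := ballConst d θ cQ with hC₁
  have hC₁0 : 0 < C₁ := ballConst_pos hθ hcQ
  set κQ := θ.β * (1 + θ.α) / e with hκQ
  set κP := θ.β * (1 + θ.α) / (2 * θ.γ * θ.β + d) with hκP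
  have hκQ0 : 0 ≤ κQ := by positivity
  have hκP0 : 0 ≤ κP := by positivity
  have hev := ((eventually_goodSize hd hθ hcQ hβ).and ((eventually_le_log 1).and
    ((eventually_le_log (2 * (θ.Cβ * C₁ ^ θ.β) * cQ ^ (1 / 2 : ℝ) / c₁)).and
      (eventually_le_log (2 * (κQ + κP) / c₁ ^ 2)))))
  obtain ⟨N, hN⟩ := Filter.eventually_atTop.1 hev
  refine ⟨2 * (A + C' + 1), max N 1, by positivity, ?_⟩
  intro ε p hp nQ nP hnQ hnP hcond τ hτ
  have := hp.prob_Q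
  obtain ⟨hgood, hl1, hl2, hl3⟩ := hN nQ ((le_max_left _ _).trans hnQ)
  have hnQ1 : 1 ≤ nQ := hgood.one_le
  have hnP1 : 1 ≤ nP := (le_max_right _ _).trans hnP
  have hnQ0 : (0 : ℝ) < nQ := by exact_mod_cast hnQ1
  have hLQ := log_le_log_max_left (n := nP) hnQ1
  have hLP := log_le_log_max_right (m := nQ) hnP1
  set L := Real.log (max nQ nP : ℕ) with hL
  have hL1 : 1 ≤ L := hl1.trans hLQ
  set T := cQ * (nQ : ℝ) ^ (2 * θ.β / e) with hT
  have hT0 : 0 < T := by positivity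
  have hk0 : 0 < kQ d θ cQ nQ := hgood.floor_pos
  have hkT : (kQ d θ cQ nQ : ℝ) ≤ T := hgood.floor_le_self
  set k := kQ d θ cQ nQ with hk
  have hk0' : (0 : ℝ) < k := by exact_mod_cast hk0
  have hτ0 : 0 < τ := lt_of_lt_of_le (by positivity) hτ
  refine ⟨hτ0, fun x hx => ?_⟩
  have hTpow : ∀ s : ℝ, T ^ s = cQ ^ s * (nQ : ℝ) ^ (2 * θ.β / e * s) := fun s => by
    rw [hT, Real.mul_rpow hcQ.le (by positivity), ← Real.rpow_mul hnQ0.le]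
  have hbias : θ.Cβ * (C₁ * (nQ : ℝ) ^ (-(1 / e))) ^ θ.β ≤ τ / 2 :=
    bias_le_threshold hcQ hc₁ (by linarith) hnQ0 hC₁0.le he0 hk0' hkT (hl2.trans hLQ) hτ
  -- Half of τ covers the bias, through the shifted level; the other half is left for the label
  -- noise.
  have htail : ∀ σ : ℝ, (σ = 1 ∨ σ = -1) → (Measure.pi fun _ : Fin nQ => p.Q)
      {D | σ * (knnEstimate k D x - (p.ηQ x - σ * (τ / 2))) ≤ -(τ / 2)} ≤
      ENNReal.ofReal (Real.exp (-T) + Real.exp (-(2 * k * (τ / 2) ^ 2))) := fun σ hσ => by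
    refine hgood.knnEstimate_tail hd hθ hp.regression_Q hp.density_Q hx hcQ hβ.le hσ
      (fun y hy => ?_) (by positivity)
    have h1 := (hp.holder_Q.abs_sub_le hβ.le hCβ.le hy.1).trans hbias
    rw [abs_le] at h1
    rcases hσ with rfl | rfl <;> linarith [h1.1, h1.2]
  have hsub : {D : Fin nQ → Obs d | τ ≤ |knnEstimate k D x - p.ηQ x|} ⊆
      {D | (1 : ℝ) * (knnEstimate k D x - (p.ηQ x - 1 * (τ / 2))) ≤ -(τ / 2)} ∪
      {D | (-1 : ℝ) * (knnEstimate k D x - (p.ηQ x - (-1) * (τ / 2))) ≤ -(τ / 2)} := fun D hD => by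
    simp only [mem_ofPred_eq] at hD
    rcases le_abs.1 hD with h | h
    · right; simp only [mem_ofPred_eq]; linarith
    · left; simp only [mem_ofPred_eq]; linarith
  -- The sample-size condition enters here; its prefactor is at least 1 and is dropped.
  have hexpT₁ : Real.exp (-T) ≤ A * sourceRate d θ nP := by
    refine le_trans ?_ hcond
    exact le_mul_of_one_le_left (Real.exp_pos _).le
      (Real.one_le_rpow (by exact_mod_cast hnQ1) (by positivity))
  have hexpT₂ : Real.exp (-T) ≤ C' * targetRate d θ nQ nP := by
    have h1 := hexp T hT0
    have e1 : 2 * θ.β / e * -((1 + θ.α) / 2) = -(θ.β * (1 + θ.α) / e) := by field_simp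
    rw [hTpow, e1, ← mul_assoc] at h1
    exact h1.trans (mul_le_mul_of_nonneg_left (rpow_le_targetRate hθ hL1) hC'0.le)
  -- The sum of the two rate exponents lets one bound serve both rates, because `L` dominates log
  -- n_Q and log n_P.
  have hexpH : Real.exp (-(2 * k * (τ / 2) ^ 2)) ≤ Real.exp (-((κQ + κP) * L)) := by
    refine exp_neg_threshold_le hk0' hc₁ (by linarith) hτ ?_
    have := hl3.trans hLQ
    rw [div_le_iff₀ (by positivity)] at this
    linarith
  have hsrc : Real.exp (-((κQ + κP) * L)) ≤ sourceRate d θ nP :=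
    exp_neg_mul_le_rpow hnP1 hκP0 (by linarith) hLP
  have htgt : Real.exp (-((κQ + κP) * L)) ≤ targetRate d θ nQ nP :=
    (exp_neg_mul_le_rpow hnQ1 hκQ0 (by linarith) hLQ).trans (rpow_le_targetRate hθ hL1)
  have hs0 : 0 ≤ sourceRate d θ nP := by unfold sourceRate; positivity
  have ht0 : 0 ≤ targetRate d θ nQ nP := (Real.exp_pos _).le.trans htgt
  have hfin : Real.exp (-T) + Real.exp (-(2 * k * (τ / 2) ^ 2)) ≤
      (A + C' + 1) * min (sourceRate d θ nP) (targetRate d θ nQ nP) :=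
    add_le_mul_min hs0 ht0 hA.le hC'0.le hexpT₁ hexpT₂ (hexpH.trans hsrc) (hexpH.trans htgt)
  calc _ ≤ _ := measure_mono hsub
    _ ≤ _ := measure_union_le _ _
    _ ≤ _ := add_le_add (htail 1 (Or.inl rfl)) (htail (-1) (Or.inr rfl))
    _ = ENNReal.ofReal (2 * (Real.exp (-T) + Real.exp (-(2 * k * (τ / 2) ^ 2)))) := by
      rw [← ENNReal.ofReal_add (by positivity) (by positivity)]
      congr 1
      ring
    _ ≤ _ := ENNReal.ofReal_le_ofReal (by linarith)

/-- The mass bound of the threshold region is of the order of the target rate. -/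
lemma exists_threshold_le (hd : 0 < d) {θ : NPParams} (hθ : θ.Valid) (hβ : 0 < θ.β)
    {cQ c₂ : ℝ} (hcQ : 0 < cQ) (hc₂ : 0 < c₂) :
    ∃ (K : ℝ) (N : ℕ), 0 < K ∧ ∀ nQ nP : ℕ, N ≤ nQ → ∀ τ : ℝ, 0 < τ →
      τ ≤ c₂ * (Real.log (max nQ nP : ℕ) * (kQ d θ cQ nQ : ℝ) ^ (-(1 / 2) : ℝ)) →
      τ ^ (1 + θ.α) ≤ K * targetRate d θ nQ nP := by
  have hα := hθ.α_nonneg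
  obtain ⟨N, hN⟩ := Filter.eventually_atTop.1 (eventually_goodSize hd hθ hcQ hβ)
  refine ⟨(c₂ * (cQ / 2) ^ (-(1 / 2) : ℝ)) ^ (1 + θ.α), N, by positivity, ?_⟩
  intro nQ nP hnQ τ hτ0 hτ
  have hgood := hN nQ hnQ
  have hnQ0 : (0 : ℝ) < nQ := by exact_mod_cast hgood.one_le
  have hL0 : 0 ≤ Real.log (max nQ nP : ℕ) := Real.log_natCast_nonneg _
  set e := 2 * θ.β + d with he
  have he0 : 0 < e := by positivity
  have h1 : (kQ d θ cQ nQ : ℝ) ^ (-(1 / 2) : ℝ) ≤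
      (cQ / 2) ^ (-(1 / 2) : ℝ) * (nQ : ℝ) ^ (-(θ.β / e)) := by
    have h2 : cQ / 2 * (nQ : ℝ) ^ (2 * θ.β / e) ≤ kQ d θ cQ nQ := by
      have := hgood.le_floor
      rw [kQ]; linarith
    refine (Real.rpow_le_rpow_of_nonpos (by positivity) h2 (by norm_num)).trans (le_of_eq ?_)
    rw [Real.mul_rpow (by positivity) (by positivity), ← Real.rpow_mul hnQ0.le]
    congr 2
    field_simp
  have h3 : τ ≤ c₂ * (cQ / 2) ^ (-(1 / 2) : ℝ) *
      (Real.log (max nQ nP : ℕ) * (nQ : ℝ) ^ (-(θ.β / e))) := by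
    refine hτ.trans ?_
    calc _ ≤ c₂ * (Real.log (max nQ nP : ℕ) *
          ((cQ / 2) ^ (-(1 / 2) : ℝ) * (nQ : ℝ) ^ (-(θ.β / e)))) := by gcongr
      _ = _ := by ring
  refine (Real.rpow_le_rpow hτ0.le h3 (by positivity)).trans (le_of_eq ?_)
  rw [Real.mul_rpow (by positivity) (by positivity), Real.mul_rpow hL0 (by positivity),
    ← Real.rpow_mul hnQ0.le, targetRate]
  congr 3
  ring

end Target

/-! ### The source estimate -/

section Source

variable {d : ℕ}

lemma Pair.measurable_signal {p : Pair d} (hQ : Measurable p.ηQ) (hP : Measurable p.ηP) :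
    Measurable p.signal := by
  classical
  have hsgn : Measurable Real.sign := by
    unfold Real.sign
    exact Measurable.ite measurableSet_Iio measurable_const
      (Measurable.ite measurableSet_Ioi measurable_const measurable_const)
  unfold Pair.signal
  refine Measurable.ite (Measure.isClosed_support.measurableSet) ?_ measurable_const
  exact ((hsgn.comp (hQ.sub_const _)).mul (hP.sub_const _)).max measurable_const

lemma Pair.measurableSet_strongSet {p : Pair d} (hQ : Measurable p.ηQ) (hP : Measurable p.ηP)
    (γ Cγ : ℝ) : MeasurableSet (p.strongSet γ Cγ) :=
  Measure.isClosed_support.measurableSet.inter (measurableSet_le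
    (((hQ.sub_const _).abs.pow_const _).const_mul _) (Pair.measurable_signal hQ hP))

/-- At a point of the signal transfer set off the decision boundary, the source regression
function points in the right direction. -/
lemma Pair.strongSet_signal {p : Pair d} {γ Cγ : ℝ} (hCγ : 0 < Cγ) {x : Feature d}
    (hx : x ∈ p.strongSet γ Cγ) (hu : 0 < |p.ηQ x - 1 / 2|) :
    x ∈ p.ΩP ∧ Cγ * |p.ηQ x - 1 / 2| ^ γ ≤ Real.sign (p.ηQ x - 1 / 2) * (p.ηP x - 1 / 2) := by
  have h := hx.2
  -- A positive lower bound rules out both zeros in the definition of the signal: the default value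
  -- off Ω_P and the truncation of the maximum.
  have hpos : 0 < Cγ * |p.ηQ x - 1 / 2| ^ γ := by positivity
  unfold Pair.signal at h
  split_ifs at h with hP
  · refine ⟨hP, (le_max_iff.1 h).resolve_right (not_le.2 hpos)⟩
  · linarith

lemma kP_eq (θ : NPParams) (cP : ℝ) (nP : ℕ) :
    kP d θ cP nP =
      ⌊cP * (nP : ℝ) ^ (2 * (θ.γ * θ.β) / (2 * (θ.γ * θ.β) + d))⌋₊ := by
  rw [kP, mul_assoc 2 θ.γ θ.β]

lemma sourceRate_eq (θ : NPParams) (nP : ℕ) :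
    sourceRate d θ nP = ((nP : ℝ) ^ (-(θ.β / (2 * (θ.γ * θ.β) + d)))) ^ (1 + θ.α) := by
  rw [sourceRate, ← Real.rpow_mul (Nat.cast_nonneg _), mul_assoc 2 θ.γ θ.β]
  congr 1
  ring

/-- The radius within which the source neighbours are found. -/
noncomputable def sourceRadius (d : ℕ) (θ : NPParams) (cP : ℝ) (nP : ℕ) : ℝ :=
  ballConst d θ cP * (nP : ℝ) ^ (-(1 / (2 * (θ.γ * θ.β) + d)))

/-- Off the set `B`, the points of `Ω⁺` see a strong source signal at all source points within the
source radius. -/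
def GoodOff (θ : NPParams) (cP κ : ℝ) (p : Pair d) (nP : ℕ) (B : Set (Feature d)) : Prop :=
  ∀ x ∈ p.strongSet θ.γ θ.Cγ, x ∉ B → 0 < |p.ηQ x - 1 / 2| →
    ∀ y ∈ Metric.closedBall x (sourceRadius d θ cP nP) ∩ p.ΩP,
      κ * |p.ηQ x - 1 / 2| ^ θ.γ ≤ Real.sign (p.ηQ x - 1 / 2) * (p.ηP y - 1 / 2)

lemma sign_eq_one_or {r : ℝ} (hr : 0 < |r|) : Real.sign r = 1 ∨ Real.sign r = -1 := by
  rcases lt_or_gt_of_ne (abs_pos.1 hr) with h | h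
  · right; exact Real.sign_of_neg h
  · left; exact Real.sign_of_pos h

lemma abs_sub_half_le {q : ℝ} (hq : q ∈ Icc (0 : ℝ) 1) : |q - 1 / 2| ≤ 1 / 2 :=
  abs_le.2 ⟨by linarith [hq.1], by linarith [hq.2]⟩

lemma MarginAssumption.measure_le {θ : NPParams} {p : Pair d} [IsProbabilityMeasure p.Q]
    (h : MarginAssumption θ p) {t : ℝ} (ht : 0 < t) :
    p.Q.fst {x | 0 < |p.ηQ x - 1 / 2| ∧ |p.ηQ x - 1 / 2| ≤ t} ≤
      ENNReal.ofReal (θ.Cα * t ^ θ.α) := by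
  rw [← ofReal_measureReal]
  exact ENNReal.ofReal_le_ofReal (h t ht)

/-- Probability of a wrong decision of the source classifier at a point with strong signal. -/
lemma source_tail (hd : 0 < d) {θ : NPParams} (hθ : θ.Valid) {cP κ : ℝ} (hcP : 0 < cP)
    (hκ : 0 < κ) {ε : ℝ → ℝ} {p : Pair d} (hp : InClassNP θ ε p) {nP : ℕ}
    (hgood : GoodSize d θ cP (θ.γ * θ.β) nP) {x : Feature d} (hxP : x ∈ p.ΩP)
    (hu : 0 < |p.ηQ x - 1 / 2|)
    (hx : ∀ y ∈ Metric.closedBall x (sourceRadius d θ cP nP) ∩ p.ΩP,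
      κ * |p.ηQ x - 1 / 2| ^ θ.γ ≤ Real.sign (p.ηQ x - 1 / 2) * (p.ηP y - 1 / 2)) :
    (Measure.pi fun _ : Fin nP => p.P)
      {D | plugIn (knnEstimate (kP d θ cP nP) D) x ≠ plugIn p.ηQ x} ≤
    ENNReal.ofReal
      (Real.exp (-(cP * (nP : ℝ) ^ (2 * (θ.γ * θ.β) / (2 * (θ.γ * θ.β) + d)))) +
      Real.exp (-(cP * κ ^ 2 * (|p.ηQ x - 1 / 2| /
        (nP : ℝ) ^ (-(θ.β / (2 * (θ.γ * θ.β) + d)))) ^ (2 * θ.γ)))) := by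
  have := hp.prob_P
  have hγ := hθ.γ_pos
  have hβ := hθ.β_mem.1
  have hn0 : (0 : ℝ) < nP := by exact_mod_cast hgood.one_le
  have hd0 : (0 : ℝ) < d := by exact_mod_cast hd
  have hcases := sign_eq_one_or hu
  set u := |p.ηQ x - 1 / 2| with hu_def
  set σ := Real.sign (p.ηQ x - 1 / 2) with hσ_def
  have hσσ : σ * σ = 1 := by rcases hcases with h | h <;> rw [h] <;> norm_num
  -- The level lies beyond 1/2, on the correct side, by the guaranteed signal κ u^γ, so a wrong vote
  -- is a deviation by at least t = κ u^γ.
  have htail := hgood.knnEstimate_tail hd hθ hp.regression_P hp.density_P hxP hcP (by positivity)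
    hcases (L := 1 / 2 + σ * (κ * u ^ θ.γ)) (t := κ * u ^ θ.γ)
    (fun y hy => by
      have := hx y hy
      linear_combination this + κ * u ^ θ.γ * hσσ) (by positivity)
  rw [← kP_eq] at htail
  refine (measure_mono ?_).trans (htail.trans (ENNReal.ofReal_le_ofReal ?_))
  · intro D hD
    simp only [mem_ofPred_eq] at hD ⊢
    rcases lt_or_gt_of_ne (abs_pos.1 hu) with h | h
    · have hs : σ = -1 := Real.sign_of_neg h
      rw [plugIn_eq_false.2 (by linarith : p.ηQ x < 1 / 2), Bool.ne_false_iff,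
        plugIn_eq_true] at hD
      rw [hs]; linarith
    · have hs : σ = 1 := Real.sign_of_pos h
      rw [plugIn_eq_true.2 (by linarith : 1 / 2 ≤ p.ηQ x), ne_eq, Bool.not_eq_true,
        plugIn_eq_false] at hD
      rw [hs]; linarith
  · refine add_le_add le_rfl (Real.exp_le_exp.2 (neg_le_neg ?_))
    have hfl := hgood.le_floor
    rw [← kP_eq] at hfl
    -- Identifies k_P u^(2γ), up to constants, with (u/b)^(2γ); the factor 2 in Hoeffding's exponent
    -- cancels the 1/2 lost to the floor.
    have e1 : (u / (nP : ℝ) ^ (-(θ.β / (2 * (θ.γ * θ.β) + d)))) ^ (2 * θ.γ) =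
        (u ^ θ.γ) ^ 2 * (nP : ℝ) ^ (2 * (θ.γ * θ.β) / (2 * (θ.γ * θ.β) + d)) := by
      rw [Real.rpow_neg hn0.le, div_inv_eq_mul, Real.mul_rpow hu.le (by positivity),
        ← Real.rpow_mul hn0.le, ← Real.rpow_natCast, ← Real.rpow_mul hu.le]
      congr 2 <;> push_cast <;> ring
    rw [e1]
    have := mul_le_mul_of_nonneg_right hfl (sq_nonneg (κ * u ^ θ.γ))
    linarith

/-- Risk of the source classifier on the signal transfer set. -/
lemma exists_source_risk (hd : 0 < d) {θ : NPParams} (hθ : θ.Valid) (hβ : 0 < θ.β)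
    {cP κ : ℝ} (hcP : 0 < cP) (hκ : 0 < κ) :
    ∃ (K : ℝ) (N : ℕ), 0 < K ∧ ∀ (ε : ℝ → ℝ) (p : Pair d), InClassNP θ ε p →
      ∀ nP : ℕ, N ≤ nP → ∀ B : Set (Feature d), MeasurableSet B → GoodOff θ cP κ p nP B →
      ∀ KB : ℝ, 0 ≤ KB →
      ∫⁻ x in B, ENNReal.ofReal |p.ηQ x - 1 / 2| ∂p.Q.fst ≤
        ENNReal.ofReal (KB * sourceRate d θ nP) →
      ∫⁻ x in p.strongSet θ.γ θ.Cγ, ENNReal.ofReal |p.ηQ x - 1 / 2| *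
        (Measure.pi fun _ : Fin nP => p.P)
          {D | plugIn (knnEstimate (kP d θ cP nP) D) x ≠ plugIn p.ηQ x} ∂p.Q.fst ≤
        ENNReal.ofReal ((K + KB) * sourceRate d θ nP) := by
  have hα := hθ.α_nonneg
  have hγ := hθ.γ_pos
  have hd0 : (0 : ℝ) < d := by exact_mod_cast hd
  set e := 2 * (θ.γ * θ.β) + (d : ℝ) with he
  have he0 : 0 < e := by positivity
  obtain ⟨C, hC, hexp⟩ := exists_exp_neg_le_rpow (m := (1 + θ.α) / (2 * θ.γ)) (by positivity)
  obtain ⟨K, hK, hmargin⟩ := exists_lintegral_exp_margin_le hα hθ.Cα_pos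
    (c := cP * κ ^ 2) (s := 2 * θ.γ) (by positivity) (by positivity)
  obtain ⟨N, hN⟩ := Filter.eventually_atTop.1
    (eventually_goodSize hd hθ hcP (δ := θ.γ * θ.β) (by positivity))
  set C' := C * cP ^ (-((1 + θ.α) / (2 * θ.γ))) with hC'
  refine ⟨C' + K, N, by positivity, ?_⟩
  intro ε p hp nP hnP B hB hoff KB hKB hBle
  have := hp.prob_Q
  have hgood := hN nP hnP
  have hn0 : (0 : ℝ) < nP := by exact_mod_cast hgood.one_le
  have hηm := hp.regression_Q.measurable
  -- The margin scale at which the signal b^γ has the order of the noise k_P^(-1/2).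
  set b := (nP : ℝ) ^ (-(θ.β / e)) with hb
  have hb0 : 0 < b := by positivity
  have hsrc : sourceRate d θ nP = b ^ (1 + θ.α) := sourceRate_eq θ nP
  set T := cP * (nP : ℝ) ^ (2 * (θ.γ * θ.β) / e) with hT
  have hT0 : 0 < T := by positivity
  have hexpT : Real.exp (-T) ≤ C' * sourceRate d θ nP := by
    refine (hexp T hT0).trans (le_of_eq ?_)
    rw [hsrc, hT, hb, Real.mul_rpow hcP.le (by positivity), ← Real.rpow_mul hn0.le,
      ← Real.rpow_mul hn0.le, ← mul_assoc]
    congr 2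
    field_simp
  set g₁ : Feature d → ℝ≥0∞ := B.indicator fun x => ENNReal.ofReal |p.ηQ x - 1 / 2| with hg₁
  set g₂ : Feature d → ℝ≥0∞ := fun x => ENNReal.ofReal (|p.ηQ x - 1 / 2| *
    Real.exp (-(cP * κ ^ 2 * (|p.ηQ x - 1 / 2| / b) ^ (2 * θ.γ)))) with hg₂
  have hg₁m : Measurable g₁ := (hηm.sub_const _).abs.ennreal_ofReal.indicator hB
  have hpt : ∀ x ∈ p.strongSet θ.γ θ.Cγ, ENNReal.ofReal |p.ηQ x - 1 / 2| *
        (Measure.pi fun _ : Fin nP => p.P)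
          {D | plugIn (knnEstimate (kP d θ cP nP) D) x ≠ plugIn p.ηQ x} ≤
        g₁ x + (ENNReal.ofReal (Real.exp (-T)) + g₂ x) := fun x hx => by
    have := hp.prob_P
    by_cases hxB : x ∈ B
    · refine le_add_right ?_
      rw [hg₁, indicator_of_mem hxB]
      exact mul_le_of_le_one_right' prob_le_one
    · refine le_add_left ?_
      rcases (abs_nonneg (p.ηQ x - 1 / 2)).eq_or_lt with h0 | h0
      · rw [← h0]; simp
      · have hst := Pair.strongSet_signal hθ.Cγ_pos hx h0
        refine (mul_le_mul_right (source_tail hd hθ hcP hκ hp hgood hst.1 h0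
          (hoff x hx hxB h0)) _).trans ?_
        rw [← ENNReal.ofReal_mul h0.le, mul_add, ENNReal.ofReal_add (by positivity) (by positivity)]
        refine add_le_add (ENNReal.ofReal_le_ofReal ?_) le_rfl
        refine mul_le_of_le_one_left (Real.exp_pos _).le ?_
        linarith [abs_sub_half_le (hp.regression_Q.mem_Icc x)]
  calc _ ≤ ∫⁻ x in p.strongSet θ.γ θ.Cγ, (g₁ x + (ENNReal.ofReal (Real.exp (-T)) + g₂ x))
        ∂p.Q.fst := setLIntegral_mono' (Pair.measurableSet_strongSet hηm
          hp.regression_P.measurable _ _) hpt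
    _ ≤ ∫⁻ x, (g₁ x + (ENNReal.ofReal (Real.exp (-T)) + g₂ x)) ∂p.Q.fst :=
        setLIntegral_le_lintegral _ _
    _ = ∫⁻ x, g₁ x ∂p.Q.fst + (ENNReal.ofReal (Real.exp (-T)) + ∫⁻ x, g₂ x ∂p.Q.fst) := by
        rw [lintegral_add_left hg₁m, lintegral_add_left measurable_const]
        simp
    _ ≤ ENNReal.ofReal (KB * sourceRate d θ nP) + (ENNReal.ofReal (C' * sourceRate d θ nP) +
          ENNReal.ofReal (K * sourceRate d θ nP)) := by
        refine add_le_add ?_ (add_le_add (ENNReal.ofReal_le_ofReal hexpT) ?_)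
        · rw [hg₁, lintegral_indicator hB]; exact hBle
        · rw [hsrc]
          exact hmargin p.Q.fst (fun x => |p.ηQ x - 1 / 2|) (hηm.sub_const _).abs
            (fun x => abs_nonneg _) (fun t ht => hp.margin.measure_le ht) b hb0
    _ = _ := by
        have hs0 : 0 ≤ sourceRate d θ nP := by rw [hsrc]; positivity
        rw [← ENNReal.ofReal_add (by positivity) (by positivity),
          ← ENNReal.ofReal_add (by positivity) (by positivity)]
        congr 1
        ring

end Source

/-! ### Risk of the TAB classifier -/

section Core

variable {d : ℕ}

instance {Q P : Measure (Obs d)} [IsProbabilityMeasure Q] [IsProbabilityMeasure P] (nQ nP : ℕ) :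
    IsProbabilityMeasure (sampleLaw Q P nQ nP) := by
  unfold sampleLaw; infer_instance

lemma InClassNP.ambiguity_nonneg {θ : NPParams} {ε : ℝ → ℝ} {p : Pair d} (hp : InClassNP θ ε p)
    {z : ℝ} (hz : z ∈ Icc (0 : ℝ) (1 / 2)) : 0 ≤ ε z :=
  (integral_nonneg fun _ => abs_nonneg _).trans (hp.ambiguity.integral_le z hz)

lemma InClassNP.lintegral_weak_le {θ : NPParams} {ε : ℝ → ℝ} {p : Pair d} (hp : InClassNP θ ε p)
    {z : ℝ} (hz : z ∈ Icc (0 : ℝ) (1 / 2)) :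
    ∫⁻ x in {x | p.signal x ≤ θ.Cγ * |p.ηQ x - 1 / 2| ^ θ.γ ∧ |p.ηQ x - 1 / 2| ≤ z},
      ENNReal.ofReal |p.ηQ x - 1 / 2| ∂p.Q.fst ≤ ENNReal.ofReal (ε z) := by
  have := hp.prob_Q
  rw [← ofReal_integral_eq_lintegral_ofReal _ (ae_of_all _ fun _ => abs_nonneg _)]
  · exact ENNReal.ofReal_le_ofReal (hp.ambiguity.integral_le z hz)
  · exact Integrable.of_mem_Icc 0 (1 / 2)
      (hp.regression_Q.measurable.sub_const _).abs.aemeasurable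
      (ae_of_all _ fun x => ⟨abs_nonneg _, abs_sub_half_le (hp.regression_Q.mem_Icc x)⟩)

/-- A wrong decision of the TAB classifier comes from a large error of the target estimate, or from
a wrong decision of the source classifier close to the decision boundary. -/
lemma tabClassifier_ne {nQ nP : ℕ} {kQ kP : ℕ} {τ : ℝ} (hτ : 0 < τ) {η : Feature d → ℝ}
    {D : (Fin nQ → Obs d) × (Fin nP → Obs d)} {x : Feature d}
    (hne : tabClassifier kQ kP τ D x ≠ plugIn η x) :
    τ ≤ |knnEstimate kQ D.1 x - η x| ∨
      (|η x - 1 / 2| ≤ 2 * τ ∧ plugIn (knnEstimate kP D.2) x ≠ plugIn η x) := by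
  rw [or_iff_not_imp_left, not_le]
  intro hlt
  rw [abs_lt] at hlt
  unfold tabClassifier at hne
  split_ifs at hne with h
  · exfalso
    apply hne
    rcases le_abs.1 h with h | h
    · rw [plugIn_eq_true.2 (by linarith : 1 / 2 ≤ knnEstimate kQ D.1 x),
        plugIn_eq_true.2 (by linarith : 1 / 2 ≤ η x)]
    · rw [plugIn_eq_false.2 (by linarith : knnEstimate kQ D.1 x < 1 / 2),
        plugIn_eq_false.2 (by linarith : η x < 1 / 2)]
  · rw [not_le, abs_lt] at h
    exact ⟨abs_le.2 ⟨by linarith [h.1], by linarith [h.2]⟩, hne⟩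

/-- Each of the two events behind a wrong decision involves only one of the samples, so a union
bound with the marginals of the product law suffices. -/
lemma sampleLaw_ne_le {Q P : Measure (Obs d)} [IsProbabilityMeasure Q] [IsProbabilityMeasure P]
    {nQ nP : ℕ} {kQ kP : ℕ} {τ : ℝ} (hτ : 0 < τ) (η : Feature d → ℝ) (x : Feature d) :
    sampleLaw Q P nQ nP {D | tabClassifier kQ kP τ D x ≠ plugIn η x} ≤
      (Measure.pi fun _ : Fin nQ => Q) {D | τ ≤ |knnEstimate kQ D x - η x|} +
      {x | |η x - 1 / 2| ≤ 2 * τ}.indicator (fun x => (Measure.pi fun _ : Fin nP => P)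
        {D | plugIn (knnEstimate kP D) x ≠ plugIn η x}) x := by
  set A := {D : Fin nQ → Obs d | τ ≤ |knnEstimate kQ D x - η x|}
  set B := {D : Fin nP → Obs d | plugIn (knnEstimate kP D) x ≠ plugIn η x}
  have hA : sampleLaw Q P nQ nP (A ×ˢ univ) = (Measure.pi fun _ : Fin nQ => Q) A := by
    rw [sampleLaw, Measure.prod_prod, measure_univ, mul_one]
  have hB : sampleLaw Q P nQ nP (univ ×ˢ B) = (Measure.pi fun _ : Fin nP => P) B := by
    rw [sampleLaw, Measure.prod_prod, measure_univ, one_mul]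
  by_cases hx : |η x - 1 / 2| ≤ 2 * τ
  · rw [indicator_of_mem (by exact hx)]
    refine (measure_mono (t := A ×ˢ univ ∪ univ ×ˢ B) fun D hD => ?_).trans
      ((measure_union_le _ _).trans (by rw [hA, hB]))
    rcases tabClassifier_ne hτ hD with h | h
    · left; exact ⟨h, trivial⟩
    · right; exact ⟨trivial, h.2⟩
  · rw [indicator_of_notMem (by exact hx), add_zero, ← hA]
    refine measure_mono fun D hD => ?_
    rcases tabClassifier_ne hτ hD with h | h
    · exact ⟨h, trivial⟩
    · exact absurd h.1 hx

/-- Margin bound for `∫ |η^Q - 1/2|` close to the decision boundary. -/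
lemma InClassNP.lintegral_margin_le {θ : NPParams} {ε : ℝ → ℝ} {p : Pair d}
    (hp : InClassNP θ ε p) {t : ℝ} (ht : 0 < t) :
    ∫⁻ x in {x | |p.ηQ x - 1 / 2| ≤ t}, ENNReal.ofReal |p.ηQ x - 1 / 2| ∂p.Q.fst ≤
      ENNReal.ofReal (θ.Cα * t ^ (1 + θ.α)) := by
  have := hp.prob_Q
  have hηm := hp.regression_Q.measurable
  have hm1 : MeasurableSet {x | |p.ηQ x - 1 / 2| ≤ t} :=
    measurableSet_le (hηm.sub_const _).abs measurable_const
  have hm2 : MeasurableSet {x | 0 < |p.ηQ x - 1 / 2| ∧ |p.ηQ x - 1 / 2| ≤ t} :=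
    (measurableSet_lt measurable_const (hηm.sub_const _).abs).inter hm1
  rw [← lintegral_indicator hm1]
  calc _ ≤ ∫⁻ x, {x | 0 < |p.ηQ x - 1 / 2| ∧ |p.ηQ x - 1 / 2| ≤ t}.indicator
        (fun _ => ENNReal.ofReal t) x ∂p.Q.fst := by
        refine lintegral_mono fun x => ?_
        by_cases hx : |p.ηQ x - 1 / 2| ≤ t
        · rw [indicator_of_mem (by exact hx)]
          rcases (abs_nonneg (p.ηQ x - 1 / 2)).eq_or_lt with h0 | h0
          · rw [← h0]; simp
          · rw [indicator_of_mem (by exact ⟨h0, hx⟩)]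
            exact ENNReal.ofReal_le_ofReal hx
        · rw [indicator_of_notMem (by exact hx)]; exact zero_le
    _ = ENNReal.ofReal t * p.Q.fst {x | 0 < |p.ηQ x - 1 / 2| ∧ |p.ηQ x - 1 / 2| ≤ t} :=
        lintegral_indicator_const hm2 _
    _ ≤ ENNReal.ofReal t * ENNReal.ofReal (θ.Cα * t ^ θ.α) :=
        mul_le_mul_right (hp.margin.measure_le ht) _
    _ = _ := by
        rw [← ENNReal.ofReal_mul ht.le, Real.rpow_add ht, Real.rpow_one]
        congr 1; ring

/-- The risk near the decision boundary, on the points of `Ω⁺` and on the weak-signal points. -/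
lemma lintegral_near_boundary_le {θ : NPParams} {ε : ℝ → ℝ} {p : Pair d}
    (hp : InClassNP θ ε p) {τ : ℝ} (hτ : 0 < τ) {w : Feature d → ℝ≥0∞} (hw : ∀ x, w x ≤ 1)
    {S : ℝ} (hS : 0 ≤ S)
    (hstrong : ∫⁻ x in p.strongSet θ.γ θ.Cγ, ENNReal.ofReal |p.ηQ x - 1 / 2| * w x ∂p.Q.fst ≤
      ENNReal.ofReal S) :
    ∫⁻ x in {x | |p.ηQ x - 1 / 2| ≤ 2 * τ}, ENNReal.ofReal |p.ηQ x - 1 / 2| * w x ∂p.Q.fst ≤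
      ENNReal.ofReal (min S (θ.Cα * (2 * τ) ^ (1 + θ.α)) + ε (min (2 * τ) (1 / 2))) := by
  have := hp.prob_Q
  have hηm := hp.regression_Q.measurable
  have hz : min (2 * τ) (1 / 2) ∈ Icc (0 : ℝ) (1 / 2) :=
    ⟨le_min (by linarith) (by norm_num), min_le_right _ _⟩
  have hε := hp.ambiguity_nonneg hz
  set z := min (2 * τ) (1 / 2) with hz_def
  rw [← min_add_add_right]
  have h1 : ∫⁻ x in {x | |p.ηQ x - 1 / 2| ≤ 2 * τ}, ENNReal.ofReal |p.ηQ x - 1 / 2| * w x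
      ∂p.Q.fst ≤ ENNReal.ofReal (S + ε z) := by
    rw [ENNReal.ofReal_add hS hε]
    refine le_trans ?_ (add_le_add hstrong (hp.lintegral_weak_le hz))
    refine le_trans ?_ (add_le_add le_rfl (lintegral_mono fun x =>
      mul_le_of_le_one_right' (hw x)))
    refine le_trans ?_ (lintegral_union_le _ _ _)
    refine lintegral_mono_set' ?_
    have hsupp : ∀ᵐ x ∂p.Q.fst, x ∈ p.Ω := Measure.support_mem_ae
    filter_upwards [hsupp] with x hx hxu
    -- A point of Ω outside Ω⁺ fails the signal inequality, hence belongs to the weak set that ε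
    -- controls. The truncation of 2τ at 1/2 is harmless as u ≤ 1/2.
    by_cases hst : x ∈ p.strongSet θ.γ θ.Cγ
    · exact Or.inl hst
    · refine Or.inr ⟨?_, le_min hxu (abs_sub_half_le (hp.regression_Q.mem_Icc x))⟩
      by_contra hcon
      exact hst ⟨hx, (not_le.1 hcon).le⟩
  have h2 : ∫⁻ x in {x | |p.ηQ x - 1 / 2| ≤ 2 * τ}, ENNReal.ofReal |p.ηQ x - 1 / 2| * w x
      ∂p.Q.fst ≤ ENNReal.ofReal (θ.Cα * (2 * τ) ^ (1 + θ.α) + ε z) := by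
    refine (lintegral_mono fun x => mul_le_of_le_one_right' (hw x)).trans
      ((hp.lintegral_margin_le (by linarith)).trans (ENNReal.ofReal_le_ofReal (by linarith)))
  rcases min_choice (S + ε z) (θ.Cα * (2 * τ) ^ (1 + θ.α) + ε z) with h | h <;> rw [h]
  · exact h1
  · exact h2

/-- If the points of `Ω⁺` without strong source signal in their neighbourhood carry little risk,
then the TAB classifier attains the rate. -/
theorem exists_tabRiskBound (hd : 0 < d) {θ : NPParams} (hθ : θ.Valid) (hβ : 0 < θ.β)
    {cQ cP A c₁ c₂ κ KB : ℝ} (hcQ : 0 < cQ) (hcP : 0 < cP) (hA : 0 < A) (hc₁ : 0 < c₁)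
    (hc₂ : c₁ ≤ c₂) (hκ : 0 < κ) (hKB : 0 ≤ KB) (N₀ : ℕ) :
    ∃ (C : ℝ) (N : ℕ), 0 < C ∧ ∀ (ε : ℝ → ℝ) (p : Pair d), InClassNP θ ε p →
      (∀ nP : ℕ, N₀ ≤ nP → ∃ B : Set (Feature d), MeasurableSet B ∧ GoodOff θ cP κ p nP B ∧
        ∫⁻ x in B, ENNReal.ofReal |p.ηQ x - 1 / 2| ∂p.Q.fst ≤
          ENNReal.ofReal (KB * sourceRate d θ nP)) →
      TabRiskBound θ ε cQ cP A c₁ c₂ p C N := by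
  have hα := hθ.α_nonneg
  have hCα := hθ.Cα_pos
  obtain ⟨K₁, N₁, hK₁, h₁⟩ := exists_target_tail hd hθ hβ hcQ hA hc₁
  obtain ⟨K₂, N₂, hK₂, h₂⟩ := exists_threshold_le hd hθ hβ hcQ (hc₁.trans_le hc₂)
  obtain ⟨K₃, N₃, hK₃, h₃⟩ := exists_source_risk hd hθ hβ hcP hκ
  set C₂ := θ.Cα * (2 ^ (1 + θ.α) * K₂) with hC₂
  have hC₂0 : 0 < C₂ := by positivity
  refine ⟨K₁ + 2 * (K₃ + KB + C₂) + 2, max (max N₁ N₂) (max N₃ N₀), by positivity, ?_⟩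
  intro ε p hp hB nQ nP hnQ hnP hcond τ hτ₁ hτ₂
  simp only [max_le_iff] at hnQ hnP
  obtain ⟨hτ, hQtail⟩ := h₁ ε p hp nQ nP hnQ.1.1 hnP.1.1 hcond τ hτ₁
  have hthr := h₂ nQ nP hnQ.1.2 τ hτ hτ₂
  obtain ⟨B, hBm, hBoff, hBle⟩ := hB nP hnP.2.2
  have hsrc := h₃ ε p hp nP hnP.2.1 B hBm hBoff KB hKB hBle
  have := hp.prob_Q
  have := hp.prob_P
  have hηm := hp.regression_Q.measurable
  have hs0 : 0 ≤ sourceRate d θ nP := by unfold sourceRate; positivity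
  have ht0 : 0 ≤ targetRate d θ nQ nP := by
    have : (0 : ℝ) < τ ^ (1 + θ.α) := by positivity
    exact le_of_lt (pos_of_mul_pos_right (this.trans_le hthr) hK₂.le)
  have hz : min (2 * τ) (1 / 2) ∈ Icc (0 : ℝ) (1 / 2) :=
    ⟨le_min (by linarith) (by norm_num), min_le_right _ _⟩
  have hε := hp.ambiguity_nonneg hz
  set m := min (sourceRate d θ nP) (targetRate d θ nQ nP) with hm
  have hm0 : 0 ≤ m := le_min hs0 ht0
  set z := min (2 * τ) (1 / 2) with hz_def
  refine hp.regression_Q.integral_excessRisk_le (measurable_tabClassifier _ _ τ) (by positivity) ?_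
  set w : Feature d → ℝ≥0∞ := fun x => (Measure.pi fun _ : Fin nP => p.P)
    {D | plugIn (knnEstimate (kP d θ cP nP) D) x ≠ plugIn p.ηQ x} with hw
  have hnear := lintegral_near_boundary_le hp hτ (w := w) (fun x => prob_le_one)
    (by positivity : 0 ≤ (K₃ + KB) * sourceRate d θ nP) hsrc
  have hUm : MeasurableSet {x | |p.ηQ x - 1 / 2| ≤ 2 * τ} :=
    measurableSet_le (hηm.sub_const _).abs measurable_const
  have hmin : min ((K₃ + KB) * sourceRate d θ nP) (θ.Cα * (2 * τ) ^ (1 + θ.α)) ≤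
      (K₃ + KB + C₂) * m := by
    rw [hm, mul_min_of_nonneg _ _ (by positivity)]
    refine min_le_min (mul_le_mul_of_nonneg_right (by linarith) hs0) ?_
    calc θ.Cα * (2 * τ) ^ (1 + θ.α) = θ.Cα * (2 ^ (1 + θ.α) * τ ^ (1 + θ.α)) := by
          rw [Real.mul_rpow two_pos.le hτ.le]
      _ ≤ θ.Cα * (2 ^ (1 + θ.α) * (K₂ * targetRate d θ nQ nP)) := by gcongr
      _ = C₂ * targetRate d θ nQ nP := by rw [hC₂]; ring
      _ ≤ _ := mul_le_mul_of_nonneg_right (by linarith) ht0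
  have hpt : ∀ᵐ x ∂p.Q.fst, ENNReal.ofReal (2 * |p.ηQ x - 1 / 2|) *
      sampleLaw p.Q p.P nQ nP
        {D | tabClassifier (kQ d θ cQ nQ) (kP d θ cP nP) τ D x ≠ plugIn p.ηQ x} ≤
      ENNReal.ofReal (K₁ * m) + 2 * {x | |p.ηQ x - 1 / 2| ≤ 2 * τ}.indicator
        (fun x => ENNReal.ofReal |p.ηQ x - 1 / 2| * w x) x := by
    have hsupp : ∀ᵐ x ∂p.Q.fst, x ∈ p.Ω := Measure.support_mem_ae
    filter_upwards [hsupp] with x hx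
    refine (mul_le_mul_right (sampleLaw_ne_le hτ p.ηQ x) _).trans ?_
    rw [mul_add]
    refine add_le_add ?_ (le_of_eq ?_)
    · refine le_trans ?_ (hQtail x hx)
      refine mul_le_of_le_one_left' (ENNReal.ofReal_le_one.2 ?_)
      linarith [abs_sub_half_le (hp.regression_Q.mem_Icc x)]
    · by_cases hxu : |p.ηQ x - 1 / 2| ≤ 2 * τ
      · rw [indicator_of_mem (by exact hxu), indicator_of_mem (by exact hxu),
          ENNReal.ofReal_mul two_pos.le, mul_assoc]
        simp [hw]
      · rw [indicator_of_notMem (by exact hxu), indicator_of_notMem (by exact hxu)]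
        simp
  calc _ ≤ _ := lintegral_mono_ae hpt
    _ = ENNReal.ofReal (K₁ * m) + 2 * ∫⁻ x in {x | |p.ηQ x - 1 / 2| ≤ 2 * τ},
          ENNReal.ofReal |p.ηQ x - 1 / 2| * w x ∂p.Q.fst := by
        rw [lintegral_add_left measurable_const, lintegral_const_mul' _ _ (by simp),
          lintegral_indicator hUm]
        simp
    _ ≤ ENNReal.ofReal (K₁ * m) +
          ENNReal.ofReal 2 * ENNReal.ofReal ((K₃ + KB + C₂) * m + ε z) := by
        rw [ENNReal.ofReal_ofNat]
        exact add_le_add le_rfl (mul_le_mul_right (hnear.trans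
          (ENNReal.ofReal_le_ofReal (by linarith))) _)
    _ = ENNReal.ofReal (K₁ * m + 2 * ((K₃ + KB + C₂) * m + ε z)) := by
        rw [← ENNReal.ofReal_mul two_pos.le, ← ENNReal.ofReal_add (by positivity) (by positivity)]
    _ ≤ _ := by
        refine ENNReal.ofReal_le_ofReal ?_
        have : 0 ≤ (K₁ + 2 * (K₃ + KB + C₂)) * ε z := by positivity
        linarith

end Core

/-! ### Geometry of the signal transfer boundary -/

section Boundary

variable {d : ℕ}

/-- Near a point of `Ω⁺` at some distance from the decision boundary, the source signal is strong
at the points of `Ω⁺`. -/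
lemma signal_of_mem_strongSet {θ : NPParams} (hθ : θ.Valid) {p : Pair d}
    (hH : HolderClass θ.β θ.Cβ p.ηQ) {r : ℝ} {x y : Feature d}
    (hu : 0 < |p.ηQ x - 1 / 2|) (hr : 2 * (θ.Cβ * r ^ θ.β) ≤ |p.ηQ x - 1 / 2|)
    (hy : y ∈ Metric.closedBall x r) (hys : y ∈ p.strongSet θ.γ θ.Cγ) :
    θ.Cγ * (1 / 2) ^ θ.γ * |p.ηQ x - 1 / 2| ^ θ.γ ≤
      Real.sign (p.ηQ x - 1 / 2) * (p.ηP y - 1 / 2) := by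
  have hCγ := hθ.Cγ_pos
  have hdiff := hH.abs_sub_le hθ.β_mem.1 hθ.Cβ_pos.le hy
  -- Moving by at most half the margin preserves the sign and at least half the margin; the latter
  -- yields the constant (1/2)^γ.
  have h1 : |p.ηQ y - p.ηQ x| ≤ |p.ηQ x - 1 / 2| / 2 := by linarith
  have h2 : |p.ηQ x - 1 / 2| / 2 ≤ |p.ηQ y - 1 / 2| := by
    have := abs_sub_abs_le_abs_sub (p.ηQ x - 1 / 2) (p.ηQ y - 1 / 2)
    rw [show p.ηQ x - 1 / 2 - (p.ηQ y - 1 / 2) = -(p.ηQ y - p.ηQ x) by ring, abs_neg] at this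
    linarith
  have hsign : Real.sign (p.ηQ y - 1 / 2) = Real.sign (p.ηQ x - 1 / 2) := by
    rw [abs_le] at h1
    rcases lt_or_gt_of_ne (abs_pos.1 hu) with h | h
    · rw [abs_of_neg h] at h1
      rw [Real.sign_of_neg h, Real.sign_of_neg (by linarith [h1.2])]
    · rw [abs_of_pos h] at h1
      rw [Real.sign_of_pos h, Real.sign_of_pos (by linarith [h1.1])]
  have h3 := (Pair.strongSet_signal hCγ hys (by linarith)).2
  rw [hsign] at h3
  refine le_trans ?_ h3
  rw [mul_assoc, ← Real.mul_rpow (by norm_num) hu.le]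
  refine mul_le_mul_of_nonneg_left (Real.rpow_le_rpow (by positivity) ?_ hθ.γ_pos.le) hCγ.le
  linarith

/-- Near a point of `Ω⁺` whose signal dominates the oscillation of the source regression function,
the source signal is strong. -/
lemma signal_of_holder {θ : NPParams} (hθ : θ.Valid) {p : Pair d}
    (hH : HolderClass θ.βP θ.CβP p.ηP) {r : ℝ} {x y : Feature d}
    (hx : x ∈ p.strongSet θ.γ θ.Cγ) (hu : 0 < |p.ηQ x - 1 / 2|)
    (hr : 2 * (θ.CβP * r ^ θ.βP) ≤ θ.Cγ * |p.ηQ x - 1 / 2| ^ θ.γ)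
    (hy : y ∈ Metric.closedBall x r) :
    θ.Cγ * (1 / 2) * |p.ηQ x - 1 / 2| ^ θ.γ ≤
      Real.sign (p.ηQ x - 1 / 2) * (p.ηP y - 1 / 2) := by
  have h1 := hH.abs_sub_le hθ.βP_mem.1 hθ.CβP_pos.le hy
  have h2 := (Pair.strongSet_signal hθ.Cγ_pos hx hu).2
  rw [abs_le] at h1
  rcases sign_eq_one_or hu with h | h <;> rw [h] at h2 ⊢ <;> linarith [h1.1, h1.2]

/-- If `S` avoided the frontier, the interior of `A` and the complement of its closure would
disconnect it. -/
lemma inter_frontier_nonempty_of_isPreconnected {X : Type*} [TopologicalSpace X] {S A : Set X}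
    (hS : IsPreconnected S) (h₁ : (S ∩ A).Nonempty) (h₂ : (S \ A).Nonempty) :
    (S ∩ frontier A).Nonempty := by
  by_contra hcon
  have hdisj : ∀ z ∈ S, z ∉ frontier A := fun z hz hzf => hcon ⟨z, hz, hzf⟩
  have hin : ∀ z ∈ S, z ∈ A → z ∈ interior A := fun z hz hzA => by
    by_contra hni
    exact hdisj z hz ⟨subset_closure hzA, hni⟩
  have hout : ∀ z ∈ S, z ∉ A → z ∈ (closure A)ᶜ := fun z hz hzA hzc =>
    hdisj z hz ⟨hzc, fun hzi => hzA (interior_subset hzi)⟩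
  obtain ⟨x, hx, hxA⟩ := h₁
  obtain ⟨y, hy, hyA⟩ := h₂
  obtain ⟨z, -, hzi, hzc⟩ := hS (interior A) (closure A)ᶜ isOpen_interior
    isClosed_closure.isOpen_compl
    (fun z hz => (em (z ∈ A)).imp (hin z hz) (hout z hz)) ⟨x, hx, hin x hx hxA⟩
    ⟨y, hy, hout y hy hyA⟩
  exact hzc (interior_subset_closure hzi)

/-- If the signal transfer boundary is part of the decision boundary, then `Ω⁺` is left only near
the decision boundary. -/
lemma BoundaryInDecisionBoundary.abs_le {θ : NPParams} (hθ : θ.Valid) {p : Pair d}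
    (h : BoundaryInDecisionBoundary θ p) (hH : HolderClass θ.β θ.Cβ p.ηQ) {r : ℝ}
    {x y : Feature d} (hx : x ∈ p.strongSet θ.γ θ.Cγ) (hy : y ∉ p.strongSet θ.γ θ.Cγ)
    (hxy : y ∈ Metric.closedBall x r) : |p.ηQ x - 1 / 2| ≤ θ.Cβ * r ^ θ.β := by
  -- The segment from x to y starts in Ω⁺ and ends outside, so it meets the frontier; at that point
  -- η^Q = 1/2, and it is still within r of x. Convexity of Ω plays no role.
  obtain ⟨z, hz, hzf⟩ := inter_frontier_nonempty_of_isPreconnected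
    (convex_segment (𝕜 := ℝ) x y).isPreconnected
    ⟨x, left_mem_segment ℝ x y, hx⟩ ⟨y, right_mem_segment ℝ x y, hy⟩
  have hr : 0 ≤ r := dist_nonneg.trans hxy
  have hzb : z ∈ Metric.closedBall x r :=
    (convex_closedBall x r).segment_subset (Metric.mem_closedBall_self hr) hxy hz
  have hzη := (h.frontier_subset hzf).2
  have := hH.abs_sub_le hθ.β_mem.1 hθ.Cβ_pos.le hzb
  rwa [hzη, abs_sub_comm] at this

/-- A boundary margin bounds the mass of the points of `Ω⁺` close to weak points of `S`. -/
lemma exists_boundaryMargin_exponent {θ : NPParams} (hθ : θ.Valid) {αr : ℝ≥0∞} {rm Cr : ℝ}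
    (hCr : 0 < Cr)
    (hle : ENNReal.ofReal (θ.β * (1 + θ.α)) ≤ ENNReal.ofReal (θ.βP / θ.γ) + αr) :
    ∃ s : ℝ, 0 ≤ s ∧ θ.β * (1 + θ.α) ≤ θ.βP / θ.γ + s ∧
      ∀ (p : Pair d) (S : Set (Feature d)), BoundaryMargin θ p S αr rm Cr →
        ∀ r : ℝ, 0 < r → r < rm → p.Q.fst.real (p.nearWeak θ.γ θ.Cγ S r) ≤ Cr * r ^ s := by
  have hα := hθ.α_nonneg
  have hβ := hθ.β_mem.1
  have hβP := hθ.βP_mem.1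
  have hγ := hθ.γ_pos
  by_cases htop : αr = ⊤
  -- For an infinite exponent the near-weak set is empty below radius `rm`, so any finite exponent
  -- is admissible; this one meets the rate condition by itself.
  · refine ⟨θ.β * (1 + θ.α), by positivity, le_add_of_nonneg_left (by positivity), ?_⟩
    intro p S h r hr hrm
    have hempty : p.nearWeak θ.γ θ.Cγ S r = ∅ := by
      refine eq_empty_of_forall_notMem fun x hx => hx.2 fun y hy => ?_
      by_contra hys
      have h1 := h.2 htop x hx.1 y ⟨hy.2, hys⟩
      have h2 : dist y x ≤ r := hy.1
      rw [dist_comm] at h2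
      linarith
    rw [hempty, measureReal_empty]
    positivity
  · refine ⟨αr.toReal, ENNReal.toReal_nonneg, ?_, fun p S h => h.1 htop⟩
    rw [← ENNReal.ofReal_toReal htop, ← ENNReal.ofReal_add (by positivity)
      ENNReal.toReal_nonneg] at hle
    exact (ENNReal.ofReal_le_ofReal_iff (by positivity)).1 hle

/-- The measurable hull has the same mass as `W`, so measurability of the set of points close to
weak ones never has to be established. -/
lemma lintegral_toMeasurable_inter_le {X : Type*} [MeasurableSpace X] {ν : Measure X}
    [IsFiniteMeasure ν] {u : X → ℝ} (hu : Measurable u) (W : Set X) {t M : ℝ} (ht : 0 ≤ t)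
    (hM : ν.real W ≤ M) :
    ∫⁻ x in toMeasurable ν W ∩ {x | u x ≤ t}, ENNReal.ofReal (u x) ∂ν ≤
      ENNReal.ofReal (t * M) := by
  calc _ ≤ ∫⁻ x in toMeasurable ν W, ENNReal.ofReal t ∂ν := by
        refine (setLIntegral_mono' ((measurableSet_toMeasurable ν W).inter
          (measurableSet_le hu measurable_const)) fun x hx => ENNReal.ofReal_le_ofReal hx.2).trans
          (lintegral_mono_set inter_subset_left)
    _ = ENNReal.ofReal t * ν W := by rw [setLIntegral_const, measure_toMeasurable]
    _ ≤ _ := by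
        rw [← ofReal_measureReal, ← ENNReal.ofReal_mul ht]
        exact ENNReal.ofReal_le_ofReal (mul_le_mul_of_nonneg_left hM ht)

end Boundary

/-! ### Rates -/

section Rates

variable {d : ℕ}

lemma rpow_rate_eq {H c n E β α : ℝ} (hH : 0 ≤ H) (hc : 0 ≤ c) (hn : 0 ≤ n) :
    (H * (c * n ^ (-(1 / E))) ^ β) ^ (1 + α) =
      (H * c ^ β) ^ (1 + α) * n ^ (-(β * (1 + α) / E)) := by
  rw [Real.mul_rpow hc (by positivity), ← mul_assoc, Real.mul_rpow (by positivity) (by positivity),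
    ← Real.rpow_mul hn, ← Real.rpow_mul hn]
  congr 2
  ring

/-- Height times mass: the exponents b/E and s/E add up, and a ≤ b + s is the condition β_P/γ + α_r
≥ β(1+α). -/
lemma rpow_margin_rate_le {H c n E a b s Cr : ℝ} (hH : 0 ≤ H) (hc : 0 ≤ c) (hn : 1 ≤ n)
    (hE : 0 < E) (hCr : 0 ≤ Cr) (hs : a ≤ b + s) :
    H * n ^ (-(b / E)) * (Cr * (c * n ^ (-(1 / E))) ^ s) ≤ H * Cr * c ^ s * n ^ (-(a / E)) := by
  have hn0 : 0 < n := by linarith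
  rw [Real.mul_rpow hc (by positivity), ← Real.rpow_mul hn0.le]
  have h1 : n ^ (-(b / E)) * n ^ (-(1 / E) * s) ≤ n ^ (-(a / E)) := by
    rw [← Real.rpow_add hn0]
    refine Real.rpow_le_rpow_of_exponent_le hn ?_
    have : a / E ≤ (b + s) / E := div_le_div_of_nonneg_right hs hE.le
    have e : (b + s) / E = b / E + 1 / E * s := by ring
    linarith
  calc _ = H * Cr * c ^ s * (n ^ (-(b / E)) * n ^ (-(1 / E) * s)) := by ring
    _ ≤ _ := mul_le_mul_of_nonneg_left h1 (by positivity)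

lemma sourceRate_nonneg (θ : NPParams) (nP : ℕ) : 0 ≤ sourceRate d θ nP := by
  unfold sourceRate; positivity

lemma targetRate_nonneg (θ : NPParams) (nQ nP : ℕ) : 0 ≤ targetRate d θ nQ nP := by
  have := Real.log_natCast_nonneg (max nQ nP)
  unfold targetRate; positivity

lemma BoundaryRiskBound.mono {θ : NPParams} {cb : ℝ} {p : Pair d} {C C' : ℝ} {N N' : ℕ}
    (h : BoundaryRiskBound θ cb p C N) (hC : C ≤ C') (hN : N ≤ N') :
    BoundaryRiskBound θ cb p C' N' := fun nP hnP =>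
  (h nP (hN.trans hnP)).trans (mul_le_mul_of_nonneg_right hC (sourceRate_nonneg θ nP))

/-- Enlarging `C` requires a nonnegative bracket; ε is nonnegative because it dominates the integral
of a nonnegative function. -/
lemma TabRiskBound.mono {θ : NPParams} {ε : ℝ → ℝ} {cQ cP A c₁ c₂ : ℝ} {p : Pair d}
    {C C' : ℝ} {N N' : ℕ} (hc₁ : 0 < c₁) (hp : InClassNP θ ε p)
    (h : TabRiskBound θ ε cQ cP A c₁ c₂ p C N) (hC : C ≤ C') (hN : N ≤ N') :
    TabRiskBound θ ε cQ cP A c₁ c₂ p C' N' := by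
  intro nQ nP hnQ hnP hcond τ hτ₁ hτ₂
  obtain ⟨hi, hb⟩ := h nQ nP (hN.trans hnQ) (hN.trans hnP) hcond τ hτ₁ hτ₂
  have hlog := Real.log_natCast_nonneg (max nQ nP)
  have hτ : 0 ≤ τ := le_trans (by positivity) hτ₁
  have hε := hp.ambiguity_nonneg (z := min (2 * τ) (1 / 2))
    ⟨le_min (by linarith) (by norm_num), min_le_right _ _⟩
  refine ⟨hi, hb.trans (mul_le_mul_of_nonneg_right hC (add_nonneg (le_min ?_ ?_) hε))⟩
  · exact sourceRate_nonneg θ nP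
  · exact targetRate_nonneg θ nQ nP

/-- For `β = 0` the rates are bounded below, and the trivial bound on the risk suffices. -/
lemma exists_tabRiskBound_of_beta_eq_zero {θ : NPParams} (hθ : θ.Valid) (hβ : θ.β = 0)
    {cQ cP A c₁ c₂ : ℝ} (hc₁ : 0 < c₁) :
    ∃ N : ℕ, ∀ (ε : ℝ → ℝ) (p : Pair d), InClassNP θ ε p →
      TabRiskBound θ ε cQ cP A c₁ c₂ p 1 N := by
  obtain ⟨N, hN⟩ := Filter.eventually_atTop.1 (eventually_le_log 1)
  refine ⟨max N 1, fun ε p hp nQ nP hnQ hnP _ τ hτ₁ _ => ?_⟩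
  have := hp.prob_Q
  have := hp.prob_P
  have hα := hθ.α_nonneg
  have hlog : 1 ≤ Real.log (max nQ nP : ℕ) :=
    (hN nQ ((le_max_left _ _).trans hnQ)).trans
      (log_le_log_max_left ((le_max_right _ _).trans hnQ))
  have hτ : 0 ≤ τ := le_trans (by positivity) hτ₁
  have hε := hp.ambiguity_nonneg (z := min (2 * τ) (1 / 2))
    ⟨le_min (by linarith) (by norm_num), min_le_right _ _⟩
  have h1 : 1 ≤ min (sourceRate d θ nP) (targetRate d θ nQ nP) := by
    refine le_min ?_ (le_trans ?_ (rpow_le_targetRate hθ hlog)) <;> simp [sourceRate, hβ]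
  refine hp.regression_Q.integral_excessRisk_le (measurable_tabClassifier _ _ τ) (by linarith) ?_
  calc _ ≤ ∫⁻ _, 1 ∂p.Q.fst := by
        refine lintegral_mono fun x => ?_
        refine mul_le_one' (ENNReal.ofReal_le_one.2 ?_) prob_le_one
        linarith [abs_sub_half_le (hp.regression_Q.mem_Icc x)]
    _ = ENNReal.ofReal 1 := by simp
    _ ≤ _ := ENNReal.ofReal_le_ofReal (by linarith)

lemma InClassNP.boundaryRisk_le {θ : NPParams} {ε : ℝ → ℝ} {p : Pair d} (hp : InClassNP θ ε p)
    {cb K : ℝ} {nP : ℕ} {B : Set (Feature d)} (hB : p.transferBoundary θ cb nP ⊆ B) (hK : 0 ≤ K)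
    (hle : ∫⁻ x in B, ENNReal.ofReal |p.ηQ x - 1 / 2| ∂p.Q.fst ≤ ENNReal.ofReal K) :
    p.boundaryRisk θ cb nP ≤ K := by
  have hηm := hp.regression_Q.measurable
  rw [Pair.boundaryRisk, integral_eq_lintegral_of_nonneg_ae (ae_of_all _ fun _ => abs_nonneg _)
    (hηm.sub_const _).abs.aestronglyMeasurable]
  exact ENNReal.toReal_le_of_le_ofReal hK ((lintegral_mono_set hB).trans hle)

end Rates

/-! ### The two boundary conditions -/

section Conditions

variable {d : ℕ}

lemma sourceRadius_eq (θ : NPParams) (cP : ℝ) (nP : ℕ) :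
    sourceRadius d θ cP nP =
      ballConst d θ cP * (nP : ℝ) ^ (-(1 / (2 * θ.γ * θ.β + d))) := by
  rw [sourceRadius, mul_assoc 2 θ.γ θ.β]

/-- By `BoundaryInDecisionBoundary.abs_le`, Ω^b lies where u ≤ C_β (c_b n_P^(-1/(2γβ+d)))^β, and the
margin assumption bounds the risk there. -/
lemma exists_boundaryRiskBound_of_boundary {θ : NPParams} (hθ : θ.Valid) {cb : ℝ}
    (hcb : 0 < cb) :
    ∃ (C : ℝ) (N : ℕ), 0 < C ∧ ∀ (ε : ℝ → ℝ) (p : Pair d), InClassNP θ ε p →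
      BoundaryInDecisionBoundary θ p → BoundaryRiskBound θ cb p C N := by
  have hCα := hθ.Cα_pos
  have hCβ := hθ.Cβ_pos
  refine ⟨θ.Cα * (θ.Cβ * cb ^ θ.β) ^ (1 + θ.α), 1, by positivity, ?_⟩
  intro ε p hp hbd nP hnP
  have hn0 : (0 : ℝ) < nP := by exact_mod_cast hnP
  have hle := hp.lintegral_margin_le
    (t := θ.Cβ * (cb * (nP : ℝ) ^ (-(1 / (2 * θ.γ * θ.β + d)))) ^ θ.β) (by positivity)
  rw [rpow_rate_eq hCβ.le hcb.le hn0.le, ← mul_assoc] at hle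
  refine hp.boundaryRisk_le (fun x hx => ?_)
    (mul_nonneg (by positivity) (sourceRate_nonneg θ nP)) hle
  obtain ⟨⟨hx, hnot⟩, -⟩ := hx
  obtain ⟨y, hy, hys⟩ := not_subset.1 hnot
  exact hbd.abs_le hθ hp.holder_Q hx hys hy.1

lemma exists_tabRiskBound_of_boundary (hd : 0 < d) {θ : NPParams} (hθ : θ.Valid)
    {cQ cP A c₁ c₂ : ℝ} (hcQ : 0 < cQ) (hcP : 0 < cP) (hA : 0 < A) (hc₁ : 0 < c₁)
    (hc₂ : c₁ ≤ c₂) :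
    ∃ (C : ℝ) (N : ℕ), 0 < C ∧ ∀ (ε : ℝ → ℝ) (p : Pair d), InClassNP θ ε p →
      BoundaryInDecisionBoundary θ p → TabRiskBound θ ε cQ cP A c₁ c₂ p C N := by
  rcases hθ.β_mem.1.eq_or_lt with hβ | hβ
  · obtain ⟨N, hN⟩ := exists_tabRiskBound_of_beta_eq_zero (d := d) hθ hβ.symm
      (cQ := cQ) (cP := cP) (A := A) (c₂ := c₂) hc₁
    exact ⟨1, N, one_pos, fun ε p hp _ => hN ε p hp⟩
  have hCα := hθ.Cα_pos
  have hCβ := hθ.Cβ_pos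
  have hCγ := hθ.Cγ_pos
  have hR := ballConst_pos (d := d) hθ hcP
  obtain ⟨C, N, hC, h⟩ := exists_tabRiskBound hd hθ hβ hcQ hcP hA hc₁ hc₂
    (κ := θ.Cγ * (1 / 2) ^ θ.γ)
    (KB := θ.Cα * (2 * θ.Cβ * ballConst d θ cP ^ θ.β) ^ (1 + θ.α))
    (by positivity) (by positivity) 1
  refine ⟨C, N, hC, fun ε p hp hbd => h ε p hp fun nP hnP => ?_⟩
  have hn0 : (0 : ℝ) < nP := by exact_mod_cast hnP
  have hηm := hp.regression_Q.measurable
  have hr0 : 0 < sourceRadius d θ cP nP := by unfold sourceRadius; positivity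
  have hle := hp.lintegral_margin_le
    (t := 2 * θ.Cβ * (sourceRadius d θ cP nP) ^ θ.β) (by positivity)
  -- The exceptional set is {u ≤ 2 C_β r^β}, with r the source radius. Off it the whole ball stays
  -- in Ω⁺, since leaving would force u ≤ C_β r^β.
  refine ⟨_, measurableSet_le (hηm.sub_const _).abs measurable_const, ?_, hle.trans_eq ?_⟩
  · intro x hx hxB hu y hy
    have hxB' : 2 * θ.Cβ * (sourceRadius d θ cP nP) ^ θ.β < |p.ηQ x - 1 / 2| := not_le.1 hxB
    refine signal_of_mem_strongSet hθ hp.holder_Q hu (by linarith) hy.1 ?_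
    by_contra hys
    have h1 := hbd.abs_le hθ hp.holder_Q hx hys hy.1
    have h2 : 0 < θ.Cβ * (sourceRadius d θ cP nP) ^ θ.β := by positivity
    linarith
  · rw [sourceRadius_eq, rpow_rate_eq (by positivity) hR.le hn0.le, ← mul_assoc, sourceRate]

/-- The definition of Ω^b already caps u at order n_P^(-(β_P/γ)/(2γβ+d)); the boundary margin
supplies the mass. -/
lemma exists_boundaryRiskBound_of_margin (hd : 0 < d) {θ : NPParams} (hθ : θ.Valid) {cb : ℝ}
    (hcb : 0 < cb) {αr : ℝ≥0∞} {rm Cr : ℝ} (hrm : 0 < rm) (hCr : 0 < Cr)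
    (hαr : ENNReal.ofReal (θ.β * (1 + θ.α)) ≤ ENNReal.ofReal (θ.βP / θ.γ) + αr) :
    ∃ (C : ℝ) (N : ℕ), 0 < C ∧ ∀ (ε : ℝ → ℝ) (p : Pair d), InClassNP θ ε p →
      BoundaryMargin θ p (p.Ω ∩ p.ΩP) αr rm Cr → BoundaryRiskBound θ cb p C N := by
  obtain ⟨s, hs0, hs, hmargin⟩ := exists_boundaryMargin_exponent (d := d) hθ hCr hαr
  have hγ := hθ.γ_pos
  have hβ := hθ.β_mem.1
  have hd0 : (0 : ℝ) < d := by exact_mod_cast hd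
  have hE : 0 < 2 * θ.γ * θ.β + d := by positivity
  obtain ⟨N, hN⟩ := Filter.eventually_atTop.1
    (eventually_rpow_neg_lt (s := 1 / (2 * θ.γ * θ.β + d)) (by positivity) cb hrm)
  refine ⟨cb * Cr * cb ^ s, max N 1, by positivity, ?_⟩
  intro ε p hp hbm nP hnP
  have := hp.prob_Q
  have hn1 : (1 : ℝ) ≤ nP := by exact_mod_cast (le_max_right _ _).trans hnP
  have hW := hmargin p _ hbm _ (by positivity) (hN nP ((le_max_left _ _).trans hnP))
  have hle := lintegral_toMeasurable_inter_le (hp.regression_Q.measurable.sub_const (1 / 2)).abs _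
    (t := cb * (nP : ℝ) ^ (-((θ.βP / θ.γ) / (2 * θ.γ * θ.β + d)))) (by positivity) hW
  refine hp.boundaryRisk_le (fun x hx => ?_)
    (mul_nonneg (by positivity) (sourceRate_nonneg θ nP)) (hle.trans (ENNReal.ofReal_le_ofReal
      (rpow_margin_rate_le hcb.le hcb.le hn1 hE hCr.le hs)))
  exact ⟨subset_toMeasurable _ _ hx.1, hx.2⟩

/-- The margin is taken relative to all of Ω_P because source neighbours of a point of Ω may fall
outside Ω, and such neighbours lie outside Ω⁺. -/
lemma exists_tabRiskBound_of_margin (hd : 0 < d) {θ : NPParams} (hθ : θ.Valid)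
    {cQ cP A c₁ c₂ : ℝ} (hcQ : 0 < cQ) (hcP : 0 < cP) (hA : 0 < A) (hc₁ : 0 < c₁)
    (hc₂ : c₁ ≤ c₂) {αr : ℝ≥0∞} {rm Cr : ℝ} (hrm : 0 < rm) (hCr : 0 < Cr)
    (hαr : ENNReal.ofReal (θ.β * (1 + θ.α)) ≤ ENNReal.ofReal (θ.βP / θ.γ) + αr) :
    ∃ (C : ℝ) (N : ℕ), 0 < C ∧ ∀ (ε : ℝ → ℝ) (p : Pair d), InClassNP θ ε p →
      BoundaryMargin θ p p.ΩP αr rm Cr → TabRiskBound θ ε cQ cP A c₁ c₂ p C N := by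
  rcases hθ.β_mem.1.eq_or_lt with hβ | hβ
  · obtain ⟨N, hN⟩ := exists_tabRiskBound_of_beta_eq_zero (d := d) hθ hβ.symm
      (cQ := cQ) (cP := cP) (A := A) (c₂ := c₂) hc₁
    exact ⟨1, N, one_pos, fun ε p hp _ => hN ε p hp⟩
  obtain ⟨s, hs0, hs, hmargin⟩ := exists_boundaryMargin_exponent (d := d) hθ hCr hαr
  have hγ := hθ.γ_pos
  have hCα := hθ.Cα_pos
  have hCβ := hθ.Cβ_pos
  have hCγ := hθ.Cγ_pos
  have hCβP := hθ.CβP_pos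
  have hd0 : (0 : ℝ) < d := by exact_mod_cast hd
  have hE : 0 < 2 * θ.γ * θ.β + d := by positivity
  set R := ballConst d θ cP with hR_def
  have hR : 0 < R := ballConst_pos hθ hcP
  -- Solves C_γ t^γ = 2 C_{β_P} r^{β_P} for the height t = H n_P^(-(β_P/γ)/(2γβ+d)), above which η^P
  -- oscillates by at most half the signal.
  set H := (2 * θ.CβP / θ.Cγ * R ^ θ.βP) ^ (1 / θ.γ) with hH
  have hH0 : 0 < H := by positivity
  obtain ⟨N₀, hN₀⟩ := Filter.eventually_atTop.1
    (eventually_rpow_neg_lt (s := 1 / (2 * θ.γ * θ.β + d)) (by positivity) R hrm)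
  -- The two minimands are the losses in `signal_of_mem_strongSet` and `signal_of_holder`.
  set κ := θ.Cγ * min ((1 / 2) ^ θ.γ) (1 / 2) with hκ
  have hκ0 : 0 < κ := by positivity
  obtain ⟨C, N, hC, h⟩ := exists_tabRiskBound hd hθ hβ hcQ hcP hA hc₁ hc₂ (κ := κ)
    (KB := θ.Cα * (2 * θ.Cβ * R ^ θ.β) ^ (1 + θ.α) + H * Cr * R ^ s)
    hκ0 (by positivity) (max N₀ 1)
  refine ⟨C, N, hC, fun ε p hp hbm => h ε p hp fun nP hnP => ?_⟩
  have := hp.prob_Q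
  have hn1 : (1 : ℝ) ≤ nP := by exact_mod_cast (le_max_right _ _).trans hnP
  have hn0 : (0 : ℝ) < nP := by linarith
  have hum : Measurable fun x => |p.ηQ x - 1 / 2| :=
    (hp.regression_Q.measurable.sub_const (1 / 2)).abs
  have hreq : sourceRadius d θ cP nP = R * (nP : ℝ) ^ (-(1 / (2 * θ.γ * θ.β + d))) :=
    sourceRadius_eq θ cP nP
  set r := sourceRadius d θ cP nP with hr
  have hr0 : 0 < r := by rw [hreq]; positivity
  have hW := hmargin p _ hbm r hr0 (by rw [hreq]; exact hN₀ nP ((le_max_left _ _).trans hnP))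
  set t := H * (nP : ℝ) ^ (-((θ.βP / θ.γ) / (2 * θ.γ * θ.β + d))) with ht
  have ht0 : 0 < t := by positivity
  have htγ : θ.Cγ * t ^ θ.γ = 2 * (θ.CβP * r ^ θ.βP) := by
    rw [ht, hH, hreq, Real.mul_rpow (by positivity) (by positivity),
      Real.mul_rpow hR.le (by positivity), ← Real.rpow_mul (by positivity),
      ← Real.rpow_mul hn0.le, ← Real.rpow_mul hn0.le, one_div_mul_cancel hγ.ne', Real.rpow_one]
    have e1 : -(θ.βP / θ.γ / (2 * θ.γ * θ.β + d)) * θ.γ =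
        -(1 / (2 * θ.γ * θ.β + d)) * θ.βP := by field_simp
    rw [e1]
    field_simp
  have hle₁ := hp.lintegral_margin_le (t := 2 * θ.Cβ * r ^ θ.β) (by positivity)
  have hle₂ := lintegral_toMeasurable_inter_le hum _ ht0.le hW
  -- Two kinds of exceptional points: those with u ≤ 2 C_β r^β, and those in the hull of the
  -- near-weak set with u ≤ t.
  refine ⟨_, (measurableSet_le hum measurable_const).union
    ((measurableSet_toMeasurable _ _).inter (measurableSet_le hum measurable_const)), ?_,
    (lintegral_union_le _ _ _).trans ((add_le_add hle₁ hle₂).trans ?_)⟩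
  · intro x hx hxB hu y hy
    have hu0 : 0 ≤ |p.ηQ x - 1 / 2| ^ θ.γ := by positivity
    by_cases hxW : x ∈ p.nearWeak θ.γ θ.Cγ p.ΩP r
    · have hxt : t < |p.ηQ x - 1 / 2| := by
        by_contra hcon
        exact hxB (Or.inr ⟨subset_toMeasurable _ _ hxW, not_lt.1 hcon⟩)
      refine le_trans ?_ (signal_of_holder hθ hp.holder_P hx hu ?_ hy.1)
      · exact mul_le_mul_of_nonneg_right
          (mul_le_mul_of_nonneg_left (min_le_right _ _) hCγ.le) hu0
      · rw [← htγ]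
        exact mul_le_mul_of_nonneg_left (Real.rpow_le_rpow ht0.le hxt.le hγ.le) hCγ.le
    · have hxB' : 2 * θ.Cβ * r ^ θ.β < |p.ηQ x - 1 / 2| := by
        by_contra hcon
        exact hxB (Or.inl (not_lt.1 hcon))
      have hball : Metric.closedBall x r ∩ p.ΩP ⊆ p.strongSet θ.γ θ.Cγ := by
        by_contra hcon
        exact hxW ⟨hx, hcon⟩
      refine le_trans ?_ (signal_of_mem_strongSet hθ hp.holder_Q hu (by linarith) hy.1 (hball hy))
      exact mul_le_mul_of_nonneg_right
        (mul_le_mul_of_nonneg_left (min_le_left _ _) hCγ.le) hu0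
  · rw [← ENNReal.ofReal_add (by positivity) (by positivity)]
    refine ENNReal.ofReal_le_ofReal ?_
    rw [add_mul]
    refine add_le_add (le_of_eq ?_) ?_
    · rw [hreq, rpow_rate_eq (by positivity) hR.le hn0.le, ← mul_assoc, sourceRate]
    · rw [hreq, ht]
      exact rpow_margin_rate_le hH0.le hR.le hn1 hE hCr.le hs

end Conditions

end TransferKNN

theorem mainTheorem11 {d : ℕ} (hd : 0 < d) (θ : TransferKNN.NPParams) (hθ : θ.Valid)
    (hβP : θ.βP ≤ θ.γ * θ.β)
    (cQ cP cb A c₁ c₂ : ℝ) (hcQ : 0 < cQ) (hcP : 0 < cP) (hcb : 0 < cb) (hA : 0 < A)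
    (hc₁ : 0 < c₁) (hc₂ : c₁ ≤ c₂) :
    -- the signal transfer boundary is part of the decision boundary
    (∃ (C : ℝ) (N : ℕ), 0 < C ∧
      ∀ (ε : ℝ → ℝ) (p : TransferKNN.Pair d), TransferKNN.InClassNP θ ε p →
        TransferKNN.BoundaryInDecisionBoundary θ p →
          TransferKNN.BoundaryRiskBound θ cb p C N ∧
          TransferKNN.TabRiskBound θ ε cQ cP A c₁ c₂ p C N) ∧
    -- signal transfer boundary margin
    (∀ (αr : ENNReal) (rm Cr : ℝ), 0 < rm → 0 < Cr →
      ENNReal.ofReal (θ.β * (1 + θ.α)) ≤ ENNReal.ofReal (θ.βP / θ.γ) + αr →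
      ∃ (C : ℝ) (N : ℕ), 0 < C ∧
        ∀ (ε : ℝ → ℝ) (p : TransferKNN.Pair d), TransferKNN.InClassNP θ ε p →
          (TransferKNN.BoundaryMargin θ p (p.Ω ∩ p.ΩP) αr rm Cr →
            TransferKNN.BoundaryRiskBound θ cb p C N) ∧
          (TransferKNN.BoundaryMargin θ p p.ΩP αr rm Cr →
            TransferKNN.TabRiskBound θ ε cQ cP A c₁ c₂ p C N)) := by
  refine ⟨?_, fun αr rm Cr hrm hCr hαr => ?_⟩
  · obtain ⟨C₁, N₁, hC₁, h₁⟩ :=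
      TransferKNN.exists_boundaryRiskBound_of_boundary (d := d) hθ hcb
    obtain ⟨C₂, N₂, -, h₂⟩ :=
      TransferKNN.exists_tabRiskBound_of_boundary hd hθ hcQ hcP hA hc₁ hc₂
    exact ⟨max C₁ C₂, max N₁ N₂, lt_max_of_lt_left hC₁, fun ε p hp hbd =>
      ⟨(h₁ ε p hp hbd).mono (le_max_left _ _) (le_max_left _ _),
        (h₂ ε p hp hbd).mono hc₁ hp (le_max_right _ _) (le_max_right _ _)⟩⟩
  · obtain ⟨C₁, N₁, hC₁, h₁⟩ :=
      TransferKNN.exists_boundaryRiskBound_of_margin hd hθ hcb hrm hCr hαr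
    obtain ⟨C₂, N₂, -, h₂⟩ :=
      TransferKNN.exists_tabRiskBound_of_margin hd hθ hcQ hcP hA hc₁ hc₂ hrm hCr hαr
    exact ⟨max C₁ C₂, max N₁ N₂, lt_max_of_lt_left hC₁, fun ε p hp =>
      ⟨fun hbm => (h₁ ε p hp hbm).mono (le_max_left _ _) (le_max_left _ _),
        fun hbm => (h₂ ε p hp hbm).mono hc₁ hp (le_max_right _ _) (le_max_right _ _)⟩⟩
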